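/- Let $d,p\ge 1$ and let $\omega\in C^0([0,1]^d)$ satisfy $\omega(x)>0$ for all $x\in[0,1]^d$ (for example $\omega=\det J_F$ for a map $F\in C^1([0,1]^d;\mathbb{R}^d)$ with $\det J_F>0$ on $[0,1]^d$). For $m\ge p+1$ let $\Xi_k=\{\xi_{k,1},\dots,\xi_{k,m+p+1}\}$, $1\le k\le d$, be open knot vectors on $[0,1]$, that is $$0=\xi_{k,1}=\dots=\xi_{k,p+1}<\xi_{k,p+2}\le\dots\le\xi_{k,m}<\xi_{k,m+1}=\dots=\xi_{k,m+p+1}=1,$$ with interior knots of multiplicity at most $p$. Let $h:=\max_{1\le k\le d,\ 1\le i\le m+p}(\xi_{k,i+1}-\xi_{k,i})$ be the mesh size. Let $\widehat B_{\mathbf i}(x)=\prod_{k=1}^d \widehat b^{(k)}_{i_k,p}(x_k)$, $\mathbf i\in\{1,\dots,m\}^d$, be the tensor-product B-splines, where $\widehat b^{(k)}_{i,p}$ are the B-splines of degree $p$ on $\Xi_k$ given by the Cox–de Boor recursion. Put $$[\mathbf M]_{\mathbf i,\mathbf j}=\int_{(0,1)^d}\widehat B_{\mathbf i}\widehat B_{\mathbf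 j}\,\omega\,dx,\qquad [\widehat{\mathbf M}]_{\mathbf i,\mathbf j}=\int_{(0,1)^d}\widehat B_{\mathbf i}\widehat B_{\mathbf j}\,dx,$$ $\mathbf D=\mathrm{diag}(\mathbf M)$, $\widehat{\mathbf D}=\mathrm{diag}(\widehat{\mathbf M})$, so that $\widehat{\mathbf M}$ is the Kronecker product of the univariate mass matrices, and $$\boldsymbol{\mathcal M}=\mathbf D^{1/2}\,\widehat{\mathbf D}^{-1/2}\,\widehat{\mathbf M}\,\widehat{\mathbf D}^{-1/2}\,\mathbf D^{1/2}.$$ For a symmetric positive definite matrix $\mathbf A$ let $\kappa(\mathbf A)=\lambda_{\max}(\mathbf A)/\lambda_{\min}(\mathbf A)$. Then $\mathbf M$ and $\boldsymbol{\mathcal M}$ are symmetric positive definite. Moreover, for knot vectors that are quasi-uniform with a fixed constant $\alpha>0$, meaning that $\alpha h\le\xi_{k,i+1}-\xi_{k,i}$ for every nonempty knot span $(\xi_{k,i},\xi_{k,i+1})$, $$\lim_{h\to0}\kappa\bigl(\boldsymbol{\mathcal M}^{-1/2}\,\mathbf M\,\boldsymbol{\mathcal M}^{-1/2}\bigr)=1,$$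 that is: for every $\varepsilon>0$ there is $\delta>0$, depending only on $\varepsilon,d,p,\alpha,\omega$, such that for every $m$ and all such quasi-uniform knot vectors $\Xi_1,\dots,\Xi_d$ with $h<\delta$ one has $|\kappa(\boldsymbol{\mathcal M}^{-1/2}\mathbf M\boldsymbol{\mathcal M}^{-1/2})-1|<\varepsilon$. -/

import Mathlib

namespace SplineMass

/-- An open knot vector on `[0,1]` of degree `p` with `m` basis functions. The knots are indexed
from zero, `knot 0, …, knot (m + p)`; values of `knot` beyond `m + p` play no role.
The fields say `ξ₀ = … = ξ_p = 0 < ξ_{p+1} ≤ … ≤ ξ_{m-1} < 1 = ξ_m = … = ξ_{m+p}`, and that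
an interior knot (index in `p+1, …, m-1`) is repeated at most `p` times. -/
structure OpenKnotVector (p m : ℕ) where
  knot : ℕ → ℝ
  mono : ∀ i, i < m + p → knot i ≤ knot (i + 1)
  first : ∀ i, i ≤ p → knot i = 0
  last : ∀ i, m ≤ i → i ≤ m + p → knot i = 1
  pos : ∀ i, p < i → i ≤ m + p → 0 < knot i
  lt_one : ∀ i, i < m → knot i < 1
  multiplicity : ∀ i, p < i → i + p < m → knot i < knot (i + p)

/-- The B-spline of degree `p` with index `i` on the knot sequence `t`, by the Cox-de Boor
recursion (`x / 0 = 0` in Lean, as the convention `0 / 0 = 0` requires). -/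
noncomputable def bspline (t : ℕ → ℝ) : ℕ → ℕ → ℝ → ℝ
  | 0, i, x => (Set.Ico (t i) (t (i + 1))).indicator (fun _ => 1) x
  | p + 1, i, x =>
      (x - t i) / (t (i + p + 1) - t i) * bspline t p i x +
      (t (i + p + 2) - x) / (t (i + p + 2) - t (i + 1)) * bspline t p (i + 1) x

variable {d p m : ℕ}

/-- The tensor-product B-spline with multi-index `i`. -/
noncomputable def tensorBSpline (Ξ : Fin d → OpenKnotVector p m) (i : Fin d → Fin m)
    (x : Fin d → ℝ) : ℝ :=
  ∏ k, bspline (Ξ k).knot p (i k) (x k)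

/-- The maximal length of a knot span over all directions. -/
noncomputable def meshSize (Ξ : Fin d → OpenKnotVector p m) : ℝ :=
  ⨆ q : Fin d × Fin (m + p), |(Ξ q.1).knot (q.2 + 1) - (Ξ q.1).knot q.2|

/-- Every nonempty knot span has length at least `α h`, with `h` the mesh size. -/
def QuasiUniform (α : ℝ) (Ξ : Fin d → OpenKnotVector p m) : Prop :=
  ∀ (k : Fin d) (i : ℕ), i < m + p → (Ξ k).knot i < (Ξ k).knot (i + 1) →
    α * meshSize Ξ ≤ (Ξ k).knot (i + 1) - (Ξ k).knot i

/-- The mass matrix with weight `ω` on the parametric domain `(0,1)^d`. -/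
noncomputable def massMatrix (Ξ : Fin d → OpenKnotVector p m) (ω : (Fin d → ℝ) → ℝ) :
    Matrix (Fin d → Fin m) (Fin d → Fin m) ℝ :=
  Matrix.of fun i j =>
    ∫ x in Set.univ.pi (fun _ : Fin d => Set.Ioo (0 : ℝ) 1),
      tensorBSpline Ξ i x * tensorBSpline Ξ j x * ω x

/-- The parametric mass matrix: unit weight. -/
noncomputable def parametricMass (Ξ : Fin d → OpenKnotVector p m) :
    Matrix (Fin d → Fin m) (Fin d → Fin m) ℝ :=
  massMatrix Ξ (fun _ => 1)

/-- The parametric mass matrix is the Kronecker product of the univariate mass matrices: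
its entries, in multi-index notation, are products of the univariate entries. -/
theorem parametricMass_apply (Ξ : Fin d → OpenKnotVector p m) (i j : Fin d → Fin m) :
    parametricMass Ξ i j =
      ∏ k, ∫ s in Set.Ioo (0 : ℝ) 1,
        bspline (Ξ k).knot p (i k) s * bspline (Ξ k).knot p (j k) s := by
  simp only [parametricMass, massMatrix, Matrix.of_apply, tensorBSpline, mul_one,
    ← Finset.prod_mul_distrib]
  rw [MeasureTheory.volume_pi, MeasureTheory.Measure.restrict_pi_pi]
  exact MeasureTheory.integral_fintype_prod_eq_prod
    (fun k s => bspline (Ξ k).knot p (i k) s * bspline (Ξ k).knot p (j k) s)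

/-- The preconditioner `D^{1/2} D̂^{-1/2} M̂ D̂^{-1/2} D^{1/2}`, where `D` and `D̂` are the diagonals
of the weighted mass matrix `M` and of the parametric mass matrix `M̂`. -/
noncomputable def preconditioner (Ξ : Fin d → OpenKnotVector p m) (ω : (Fin d → ℝ) → ℝ) :
    Matrix (Fin d → Fin m) (Fin d → Fin m) ℝ :=
  Matrix.diagonal (fun i => √(massMatrix Ξ ω i i)) *
    Matrix.diagonal (fun i => (√(parametricMass Ξ i i))⁻¹) *
    parametricMass Ξ *
    Matrix.diagonal (fun i => (√(parametricMass Ξ i i))⁻¹) *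
    Matrix.diagonal (fun i => √(massMatrix Ξ ω i i))

section Spectral

open scoped MatrixOrder

variable {n : Type*} [Fintype n] [DecidableEq n]

/-- `P^{-1/2} M P^{-1/2}`, with `P^{1/2}` the positive semidefinite square root of `P`. -/
noncomputable def symmPrecond (P M : Matrix n n ℝ) : Matrix n n ℝ :=
  (CFC.sqrt P)⁻¹ * M * (CFC.sqrt P)⁻¹

/-- The spectral condition number of a symmetric positive definite matrix: the largest eigenvalue
divided by the smallest one. -/
noncomputable def condNumber (A : Matrix n n ℝ) : ℝ :=
  sSup (spectrum ℝ A) / sInf (spectrum ℝ A)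

end Spectral

end SplineMass

/-!
The quadratic forms of the mass matrix `M` and of the preconditioner `P` are compared. Their
entries are `M i j = ∫ B i * B j * ω` and `P i j = e i * e j * ∫ B i * B j`, where `e i ^ 2` is the
mean of `ω` against `B i ^ 2`. Where `B i` and `B j` are both nonzero, `ω` differs from `e i * e j`
by at most the oscillation `η` of `ω` over supports, which have diameter at most `(p + 1) h`. As
`B i ≥ 0`, this gives `|M i j - P i j| ≤ η * ∫ B i * B j`
(`abs_massMatrix_sub_preconditioner_le`). At each point at most `(p + 1) ^ d` B-splines are nonzero,
so the form of `M - P` is at most `η` times a constant times the form of the diagonal of the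
parametric mass matrix (`abs_dotProduct_sub_mulVec_le`).

It remains to bound the form of this diagonal by that of `P`, uniformly in the mesh. This is the
`L²` stability of B-splines (`exists_stability_const`), proved with dual functions that are tensor
products of univariate ones. In one variable, comparing coefficients in Marsden's identity on a
knot span writes the monomials, in the local coordinate, as combinations of the `p + 1` active
B-splines. The coefficients are bounded in terms of `p` and `α`. Transposing this relation turns
functions dual to the monomials into functions dual to the B-splines, with no need to invert
anything that depends on the knots (`exists_dual_on_span`).

Hence `|M - P| ≤ θ P` as forms, with `θ` proportional to `η`, and the spectrum of
`P^{-1/2} M P^{-1/2}` lies in `[1 - θ, 1 + θ]`. Positive definiteness follows from the same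
stability estimate, because a single family of knot vectors is always quasi-uniform for some
constant.
-/

open MeasureTheory

namespace SplineMass

/-! ### Univariate B-splines: support, bounds and Marsden's identity -/

theorem bspline_eq_zero {t : ℕ → ℝ} {N : ℕ} (ht : MonotoneOn t (Set.Iic N)) (p : ℕ) :
    ∀ (i : ℕ) (x : ℝ), i + p + 1 ≤ N → x ∉ Set.Ico (t i) (t (i + p + 1)) →
      bspline t p i x = 0 := by
  induction p with
  | zero =>
    intro i x _ hx
    simpa [bspline] using hx
  | succ p ih =>
    intro i x hi hx
    have h1 : t i ≤ t (i + 1) :=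
      ht (Set.mem_Iic.2 (by omega)) (Set.mem_Iic.2 (by omega)) (by omega)
    have h2 : t (i + p + 1) ≤ t (i + p + 2) :=
      ht (Set.mem_Iic.2 (by omega)) (Set.mem_Iic.2 (by omega)) (by omega)
    have e1 : bspline t p i x = 0 :=
      ih i x (by omega) fun h => hx ⟨h.1, h.2.trans_le h2⟩
    have e2 : bspline t p (i + 1) x = 0 := by
      refine ih (i + 1) x (by omega) fun h => hx ⟨h1.trans h.1, ?_⟩
      rw [show i + (p + 1) + 1 = i + 1 + p + 1 by ring]
      exact h.2
    simp [bspline, e1, e2]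

/-- The bound `2 ^ p` is crude (B-splines are at most `1`), but it follows from the recursion
without the partition of unity. -/
theorem bspline_mem_Icc {t : ℕ → ℝ} {N : ℕ} (ht : MonotoneOn t (Set.Iic N)) (p : ℕ) :
    ∀ (i : ℕ) (x : ℝ), i + p + 1 ≤ N → bspline t p i x ∈ Set.Icc (0 : ℝ) (2 ^ p) := by
  induction p with
  | zero =>
    intro i x _
    simp only [bspline, Set.indicator]
    split_ifs <;> simp
  | succ p ih =>
    intro i x hi
    have k1 : (x - t i) / (t (i + p + 1) - t i) * bspline t p i x ∈ Set.Icc (0 : ℝ) (2 ^ p) := by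
      by_cases h : x ∈ Set.Ico (t i) (t (i + p + 1))
      · have hb := ih i x (by omega)
        have a0 : 0 ≤ (x - t i) / (t (i + p + 1) - t i) :=
          div_nonneg (by linarith [h.1]) (by linarith [h.1, h.2])
        have a1 : (x - t i) / (t (i + p + 1) - t i) ≤ 1 :=
          div_le_one_of_le₀ (by linarith [h.2]) (by linarith [h.1, h.2])
        exact ⟨mul_nonneg a0 hb.1, (mul_le_of_le_one_left hb.1 a1).trans hb.2⟩
      · rw [bspline_eq_zero ht p i x (by omega) h, mul_zero]
        exact ⟨le_rfl, by positivity⟩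
    have k2 : (t (i + p + 2) - x) / (t (i + p + 2) - t (i + 1)) * bspline t p (i + 1) x ∈
        Set.Icc (0 : ℝ) (2 ^ p) := by
      by_cases h : x ∈ Set.Ico (t (i + 1)) (t (i + 1 + p + 1))
      · have hb := ih (i + 1) x (by omega)
        rw [show i + 1 + p + 1 = i + p + 2 by ring] at h
        have a0 : 0 ≤ (t (i + p + 2) - x) / (t (i + p + 2) - t (i + 1)) :=
          div_nonneg (by linarith [h.2]) (by linarith [h.1, h.2])
        have a1 : (t (i + p + 2) - x) / (t (i + p + 2) - t (i + 1)) ≤ 1 :=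
          div_le_one_of_le₀ (by linarith [h.1]) (by linarith [h.1, h.2])
        exact ⟨mul_nonneg a0 hb.1, (mul_le_of_le_one_left hb.1 a1).trans hb.2⟩
      · rw [bspline_eq_zero ht p (i + 1) x (by omega) h, mul_zero]
        exact ⟨le_rfl, by positivity⟩
    rw [bspline, pow_succ]
    exact ⟨add_nonneg k1.1 k2.1, by linarith [k1.2, k2.2]⟩

theorem measurable_bspline (t : ℕ → ℝ) (p : ℕ) : ∀ i, Measurable (bspline t p i) := by
  induction p with
  | zero =>
    intro i
    exact measurable_const.indicator measurableSet_Ico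
  | succ p ih =>
    intro i
    have h1 := ih i
    have h2 := ih (i + 1)
    have e : bspline t (p + 1) i = fun x =>
        (x - t i) / (t (i + p + 1) - t i) * bspline t p i x +
        (t (i + p + 2) - x) / (t (i + p + 2) - t (i + 1)) * bspline t p (i + 1) x := by
      funext x
      rw [bspline]
    rw [e]
    fun_prop

/-- **Marsden's identity** on the knot span with index `q + p`, where the B-splines with indices
`q, …, q + p` are the ones that do not vanish. -/
theorem marsden {t : ℕ → ℝ} {N : ℕ} (ht : MonotoneOn t (Set.Iic N)) (p : ℕ) :
    ∀ (q : ℕ) (x y : ℝ), q + p + p + 1 ≤ N → x ∈ Set.Ico (t (q + p)) (t (q + p + 1)) →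
      ∑ j ∈ Finset.range (p + 1), (∏ k ∈ Finset.range p, (y - t (q + j + k + 1))) *
        bspline t p (q + j) x = (y - x) ^ p := by
  induction p with
  | zero =>
    intro q x y _ hx
    simpa [bspline] using hx
  | succ p ih =>
    intro q x y hq hx
    rw [show q + (p + 1) = q + 1 + p by ring] at hx
    -- of the B-splines one degree lower, the first and the last in the recursion vanish at `x`
    have h0 : bspline t p q x = 0 := by
      refine bspline_eq_zero ht p q x (by omega) fun h => ?_
      have := h.2
      rw [show q + p + 1 = q + 1 + p by ring] at this
      exact absurd hx.1 (not_le.2 this)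
    have h1 : bspline t p (q + (p + 1) + 1) x = 0 := by
      refine bspline_eq_zero ht p _ x (by omega) fun h => ?_
      have := h.1
      rw [show q + (p + 1) + 1 = q + 1 + p + 1 by ring] at this
      exact absurd hx.2 (not_lt.2 this)
    simp only [bspline, mul_add, Finset.sum_add_distrib]
    rw [Finset.sum_range_succ' _ (p + 1), Finset.sum_range_succ _ (p + 1)]
    simp only [add_zero, h0, h1, mul_zero]
    rw [← Finset.sum_add_distrib, pow_succ, ← ih (q + 1) x y (by omega) hx, Finset.sum_mul]
    refine Finset.sum_congr rfl fun j hj => ?_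
    have hj' : j ≤ p := Nat.lt_succ_iff.1 (Finset.mem_range.1 hj)
    rw [Finset.prod_range_succ, Finset.prod_range_succ' (fun k => y - t (q + j + k + 1))]
    have e : ∀ k, q + j + (k + 1) + 1 = q + 1 + j + k + 1 := fun k => by ring
    simp only [e, show q + (j + 1) = q + 1 + j by ring, show q + j + 1 = q + 1 + j by ring,
      show q + j + p + 2 = q + 1 + j + p + 1 by ring]
    by_cases hb : x ∈ Set.Ico (t (q + 1 + j)) (t (q + 1 + j + p + 1))
    · have hD : t (q + 1 + j + p + 1) - t (q + 1 + j) ≠ 0 := by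
        have := hb.1.trans_lt hb.2
        linarith
      field_simp
      ring
    · rw [bspline_eq_zero ht p _ x (by omega) hb]
      ring

/-! ### Functions dual to the monomials -/

/-- A combination of the monomials is recovered from its moments because the Gram matrix of the
monomials in `L²(0,1)` is invertible. -/
theorem exists_dual_monomials (n : ℕ) :
    ∃ η : Fin n → ℝ → ℝ, (∀ s, Continuous (η s)) ∧
      ∀ r s : Fin n, ∫ u in (0 : ℝ)..1, u ^ (r : ℕ) * η s u = if r = s then 1 else 0 := by
  classical
  let H : Matrix (Fin n) (Fin n) ℝ :=
    Matrix.of fun r s => ∫ u in (0 : ℝ)..1, u ^ (r : ℕ) * u ^ (s : ℕ)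
  have hH : IsUnit H := by
    rw [← Matrix.mulVec_injective_iff_isUnit]
    refine (injective_iff_map_eq_zero (Matrix.mulVecLin H)).2 ?_
    intro c hc
    have hc' : H.mulVec c = 0 := hc
    let Q : Polynomial ℝ := ∑ s : Fin n, Polynomial.monomial (s : ℕ) (c s)
    have hQ : ∀ u, Q.eval u = ∑ s : Fin n, c s * u ^ (s : ℕ) := fun u => by
      simp [Q, Polynomial.eval_finsetSum]
    have hint : ∫ u in (0 : ℝ)..1, Q.eval u ^ 2 = 0 := by
      have : ∀ u, Q.eval u ^ 2 =
          ∑ r : Fin n, ∑ s : Fin n, c r * (c s * (u ^ (r : ℕ) * u ^ (s : ℕ))) := fun u => by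
        rw [hQ, sq, Finset.sum_mul_sum]
        refine Finset.sum_congr rfl fun r _ => Finset.sum_congr rfl fun s _ => by ring
      simp only [this]
      rw [intervalIntegral.integral_finsetSum
        fun r _ => (by fun_prop : Continuous _).intervalIntegrable _ _]
      refine Finset.sum_eq_zero fun r _ => ?_
      rw [intervalIntegral.integral_finsetSum
        fun s _ => (by fun_prop : Continuous _).intervalIntegrable _ _]
      simp only [intervalIntegral.integral_const_mul]
      rw [← Finset.mul_sum]
      have := congrFun hc' r
      simp only [Matrix.mulVec, dotProduct, H, Matrix.of_apply, Pi.zero_apply] at this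
      rw [mul_eq_zero]
      right
      refine Eq.trans ?_ this
      exact Finset.sum_congr rfl fun s _ => mul_comm _ _
    have hzero : ∀ u ∈ Set.Icc (0 : ℝ) 1, Q.eval u = 0 := by
      intro u hu
      by_contra hne
      have hpos : 0 < ∫ u in (0 : ℝ)..1, Q.eval u ^ 2 :=
        intervalIntegral.integral_pos zero_lt_one
          (by fun_prop) (fun _ _ => sq_nonneg _) ⟨u, hu, by positivity⟩
      exact hpos.ne' hint
    have hQ0 : Q = 0 :=
      Polynomial.eq_zero_of_infinite_isRoot Q
        ((Set.Icc_infinite (zero_lt_one (α := ℝ))).mono fun u hu => hzero u hu)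
    ext s
    have : Q.coeff s = c s := by
      simp [Q, Polynomial.coeff_monomial, Fin.val_inj]
    rw [← this, hQ0]
    simp
  refine ⟨fun s u => ∑ k : Fin n, u ^ (k : ℕ) * H⁻¹ k s, fun s => by fun_prop, fun r s => ?_⟩
  have h1 : H * H⁻¹ = 1 := Matrix.mul_nonsing_inv _ ((Matrix.isUnit_iff_isUnit_det _).1 hH)
  have h2 := congrFun (congrFun h1 r) s
  rw [Matrix.one_apply, Matrix.mul_apply] at h2
  rw [← h2]
  simp only [Finset.mul_sum, ← mul_assoc]
  rw [intervalIntegral.integral_finsetSum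
    fun r _ => (by fun_prop : Continuous _).intervalIntegrable _ _]
  simp only [intervalIntegral.integral_mul_const]
  rfl

/-! ### Open knot vectors -/

namespace OpenKnotVector

variable {p m : ℕ} (Ξ : OpenKnotVector p m)

theorem degree_lt (Ξ : OpenKnotVector p m) : p < m := by
  by_contra h
  have h1 := Ξ.first p le_rfl
  have h2 := Ξ.last p (by omega) (by omega)
  linarith

theorem monotoneOn_knot : MonotoneOn Ξ.knot (Set.Iic (m + p)) := by
  intro a _ b hb hab
  rw [Set.mem_Iic] at hb
  induction b, hab using Nat.le_induction with
  | base => exact le_rfl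
  | succ n _ ih => exact (ih (by omega)).trans (Ξ.mono n (by omega))

theorem knot_le {a b : ℕ} (hab : a ≤ b) (hb : b ≤ m + p) : Ξ.knot a ≤ Ξ.knot b :=
  Ξ.monotoneOn_knot (Set.mem_Iic.2 (hab.trans hb)) (Set.mem_Iic.2 hb) hab

theorem knot_mem_Icc {a : ℕ} (ha : a ≤ m + p) : Ξ.knot a ∈ Set.Icc (0 : ℝ) 1 := by
  constructor
  · rw [← Ξ.first 0 (Nat.zero_le _)]
    exact Ξ.knot_le (Nat.zero_le _) ha
  · rw [← Ξ.last (m + p) (by omega) le_rfl]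
    exact Ξ.knot_le ha le_rfl

theorem index_of_span {l : ℕ} (hl : l < m + p) (h : Ξ.knot l < Ξ.knot (l + 1)) :
    p ≤ l ∧ l < m := by
  constructor
  · by_contra hlp
    rw [Ξ.first l (by omega), Ξ.first (l + 1) (by omega)] at h
    exact lt_irrefl _ h
  · by_contra hlm
    rw [Ξ.last l (by omega) (by omega), Ξ.last (l + 1) (by omega) (by omega)] at h
    exact lt_irrefl _ h

/-- The bound on the multiplicity of interior knots makes every B-spline support nondegenerate. -/
theorem knot_lt_of_lt {i : ℕ} (hi : i < m) : Ξ.knot i < Ξ.knot (i + p + 1) := by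
  by_cases h1 : i ≤ p
  · rw [Ξ.first i h1]
    exact Ξ.pos _ (by omega) (by omega)
  · by_cases h2 : i + p < m
    · exact (Ξ.multiplicity i (by omega) h2).trans_le (Ξ.knot_le (by omega) (by omega))
    · rw [Ξ.last (i + p + 1) (by omega) (by omega)]
      exact Ξ.lt_one i hi

theorem exists_span {i : ℕ} (hi : i < m) :
    ∃ l, i ≤ l ∧ l ≤ i + p ∧ Ξ.knot l < Ξ.knot (l + 1) := by
  by_contra! h
  have key : ∀ n, n ≤ p + 1 → Ξ.knot (i + n) ≤ Ξ.knot i := by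
    intro n
    induction n with
    | zero => simp
    | succ n ih => exact fun hn => (h (i + n) (by omega) (by omega)).trans (ih (by omega))
  exact absurd (Ξ.knot_lt_of_lt hi) (not_lt.2 (key (p + 1) le_rfl))

theorem knot_sub_le {h : ℝ} (hub : ∀ i, i < m + p → Ξ.knot (i + 1) - Ξ.knot i ≤ h) (a : ℕ) :
    ∀ n : ℕ, a + n ≤ m + p → Ξ.knot (a + n) - Ξ.knot a ≤ n * h := by
  intro n
  induction n with
  | zero => simp
  | succ n ih =>
    intro hn
    have h1 := ih (by omega)
    have h2 := hub (a + n) (by omega)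
    push_cast
    rw [← add_assoc]
    linarith

end OpenKnotVector

/-! ### Bounded dual functions in one variable -/

theorem abs_coeff_prod_X_sub_C_le {ι : Type*} (s : Finset ι) (τ : ι → ℝ) :
    ∀ r, |(∏ k ∈ s, (Polynomial.X - Polynomial.C (τ k))).coeff r| ≤ ∏ k ∈ s, (1 + |τ k|) := by
  classical
  induction s using Finset.induction_on with
  | empty =>
    intro r
    simp only [Finset.prod_empty, Polynomial.coeff_one]
    split_ifs <;> simp
  | insert a s ha ih =>
    intro r
    rw [Finset.prod_insert ha, Finset.prod_insert ha, sub_mul, Polynomial.coeff_sub,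
      Polynomial.coeff_C_mul, add_mul, one_mul]
    refine (abs_sub _ _).trans (add_le_add ?_ ?_)
    · cases r with
      | zero => simpa using Finset.prod_nonneg fun k _ => by positivity
      | succ r => rw [Polynomial.coeff_X_mul]; exact ih r
    · rw [abs_mul]
      exact mul_le_mul_of_nonneg_left (ih r) (abs_nonneg _)

/-- On a knot span, the monomials in the local coordinate are combinations of the B-splines whose
coefficients are controlled by the local quasi-uniformity of the knots: compare the coefficients
of `y` in Marsden's identity. -/
theorem exists_monomial_eq_sum_bspline {p m : ℕ} {α h : ℝ} (hα : 0 < α) (Ξ : OpenKnotVector p m)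
    (hub : ∀ i, i < m + p → Ξ.knot (i + 1) - Ξ.knot i ≤ h) {q : ℕ} (hq : q + p < m)
    (hspan : Ξ.knot (q + p) < Ξ.knot (q + p + 1))
    (hlb : α * h ≤ Ξ.knot (q + p + 1) - Ξ.knot (q + p)) :
    ∃ B : Matrix (Fin (p + 1)) (Fin (p + 1)) ℝ, (∀ r j, |B r j| ≤ (1 + p / α) ^ p) ∧
      ∀ x ∈ Set.Ico (Ξ.knot (q + p)) (Ξ.knot (q + p + 1)), ∀ r : Fin (p + 1),
        ∑ j : Fin (p + 1), B r j * bspline Ξ.knot p (q + j) x =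
          ((x - Ξ.knot (q + p)) / (Ξ.knot (q + p + 1) - Ξ.knot (q + p))) ^ (r : ℕ) := by
  set t := Ξ.knot with ht
  set H := t (q + p + 1) - t (q + p) with hH
  have hHpos : 0 < H := sub_pos.2 hspan
  let τ : ℕ → ℕ → ℝ := fun j k => (t (q + j + k + 1) - t (q + p)) / H
  let P : ℕ → Polynomial ℝ := fun j =>
    ∏ k ∈ Finset.range p, (Polynomial.X - Polynomial.C (τ j k))
  have hh : 0 < h := by
    have := hub (q + p) (by omega)
    linarith
  have hτ : ∀ j k, j ≤ p → k < p → |τ j k| ≤ p / α := by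
    intro j k hj hk
    have hnum : |t (q + j + k + 1) - t (q + p)| ≤ p * h := by
      rw [abs_le]
      rcases le_total (q + j + k + 1) (q + p) with hle | hle
      · obtain ⟨n, hn⟩ := Nat.exists_eq_add_of_le hle
        have h1 := Ξ.knot_sub_le hub (q + j + k + 1) n (by omega)
        have h2 : (n : ℝ) ≤ p := by exact_mod_cast (by omega : n ≤ p)
        have h3 := Ξ.knot_le hle (by omega)
        rw [← hn] at h1
        constructor <;> nlinarith
      · obtain ⟨n, hn⟩ := Nat.exists_eq_add_of_le hle
        have h1 := Ξ.knot_sub_le hub (q + p) n (by omega)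
        have h2 : (n : ℝ) ≤ p := by exact_mod_cast (by omega : n ≤ p)
        have h3 := Ξ.knot_le hle (by omega)
        rw [← hn] at h1
        constructor <;> nlinarith
    rw [abs_div, abs_of_pos hHpos, div_le_div_iff₀ hHpos hα]
    calc |t (q + j + k + 1) - t (q + p)| * α ≤ p * h * α :=
          mul_le_mul_of_nonneg_right hnum hα.le
      _ = p * (α * h) := by ring
      _ ≤ p * H := mul_le_mul_of_nonneg_left hlb (Nat.cast_nonneg _)
  refine ⟨Matrix.of fun r j => (-1) ^ (r : ℕ) * (P j).coeff (p - r) / (p.choose (p - r) : ℝ),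
    ?_, ?_⟩
  · intro r j
    have hr : (r : ℕ) ≤ p := Nat.lt_succ_iff.1 r.2
    have hc : (1 : ℝ) ≤ p.choose (p - r) := by
      exact_mod_cast Nat.choose_pos (Nat.sub_le p r)
    rw [Matrix.of_apply, abs_div, abs_mul, abs_pow, abs_neg, abs_one, one_pow, one_mul,
      abs_of_pos (zero_lt_one.trans_le hc)]
    refine (div_le_self (abs_nonneg _) hc).trans ((abs_coeff_prod_X_sub_C_le _ _ _).trans ?_)
    calc ∏ k ∈ Finset.range p, (1 + |τ j k|) ≤ ∏ _k ∈ Finset.range p, (1 + (p : ℝ) / α) :=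
          Finset.prod_le_prod (fun _ _ => by positivity) fun k hk =>
            add_le_add_right (hτ j k (Nat.lt_succ_iff.1 j.2) (Finset.mem_range.1 hk)) 1
      _ = _ := by simp
  · intro x hx r
    have hr : (r : ℕ) ≤ p := Nat.lt_succ_iff.1 r.2
    set u := (x - t (q + p)) / H with hu
    have hpoly : ∑ j ∈ Finset.range (p + 1), Polynomial.C (bspline t p (q + j) x) * P j =
        (Polynomial.X - Polynomial.C u) ^ p := by
      refine Polynomial.funext fun v => ?_
      have hm := marsden Ξ.monotoneOn_knot p q x (t (q + p) + H * v) (by omega) hx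
      have e1 : t (q + p) + H * v - x = H * (v - u) := by
        rw [hu]; field_simp; ring
      have e2 : ∀ i, t (q + p) + H * v - t i = H * (v - (t i - t (q + p)) / H) := fun i => by
        field_simp; ring
      simp only [← ht, e1, e2, mul_pow, Finset.prod_mul_distrib, Finset.prod_const,
        Finset.card_range, mul_assoc] at hm
      rw [← Finset.mul_sum] at hm
      have hm' := mul_left_cancel₀ (pow_ne_zero p hHpos.ne') hm
      simp only [Polynomial.eval_finsetSum, Polynomial.eval_mul, Polynomial.eval_C,
        Polynomial.eval_pow, Polynomial.eval_sub, Polynomial.eval_X, P, Polynomial.eval_prod]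
      rw [← hm']
      exact Finset.sum_congr rfl fun j _ => mul_comm _ _
    have hcoef := congrArg (fun f => f.coeff (p - r)) hpoly
    simp only [Polynomial.finsetSum_coeff, Polynomial.coeff_C_mul, sub_eq_add_neg,
      ← Polynomial.C_neg, Polynomial.coeff_X_add_C_pow] at hcoef
    rw [Nat.sub_sub_self hr, Finset.sum_range] at hcoef
    have hc : (p.choose (p - r) : ℝ) ≠ 0 :=
      Nat.cast_ne_zero.2 (Nat.choose_pos (Nat.sub_le p r)).ne'
    simp only [Matrix.of_apply]
    have e3 : ∀ j : Fin (p + 1), (-1) ^ (r : ℕ) * (P j).coeff (p - r) / (p.choose (p - r) : ℝ) *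
        bspline t p (q + j) x = (-1) ^ (r : ℕ) / (p.choose (p - r) : ℝ) *
          (bspline t p (q + j) x * (P j).coeff (p - r)) := fun j => by ring
    simp only [e3]
    rw [← Finset.mul_sum, hcoef, neg_pow u]
    have hs : ((-1 : ℝ) ^ (r : ℕ)) * (-1) ^ (r : ℕ) = 1 := by
      rw [← mul_pow]; simp
    calc _ = ((-1 : ℝ) ^ (r : ℕ) * (-1) ^ (r : ℕ)) * u ^ (r : ℕ) *
          ((p.choose (p - r) : ℝ) / (p.choose (p - r) : ℝ)) := by ring
      _ = u ^ (r : ℕ) := by rw [hs, div_self hc, one_mul, mul_one]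

theorem integral_le_of_le_indicator_Ico {f : ℝ → ℝ} {a b c : ℝ} (hab : a ≤ b) (hc : 0 ≤ c)
    (h0 : ∀ x, 0 ≤ f x) (hf : ∀ x, f x ≤ (Set.Ico a b).indicator (fun _ => c) x) :
    ∫ x in Set.Ioo (0 : ℝ) 1, f x ≤ c * (b - a) := by
  calc ∫ x in Set.Ioo (0 : ℝ) 1, f x
      ≤ ∫ x in Set.Ioo (0 : ℝ) 1, (Set.Ico a b).indicator (fun _ => c) x :=
        integral_mono_of_nonneg (ae_of_all _ h0)
          ((integrable_const c).indicator measurableSet_Ico) (ae_of_all _ hf)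
    _ ≤ ∫ x, (Set.Ico a b).indicator (fun _ => c) x :=
        setIntegral_le_integral
          ((integrable_indicator_iff measurableSet_Ico).2 (integrableOn_const (by simp)))
          (ae_of_all _ fun x => Set.indicator_nonneg (fun _ _ => hc) x)
    _ = c * (b - a) := by
        rw [integral_indicator measurableSet_Ico, setIntegral_const, smul_eq_mul, mul_comm]
        simp [Measure.real, hab]

theorem integrableOn_Ioo_of_bound {f : ℝ → ℝ} (hf : Measurable f) {c : ℝ} (hc : ∀ x, |f x| ≤ c) :
    IntegrableOn f (Set.Ioo (0 : ℝ) 1) :=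
  Integrable.of_bound hf.aestronglyMeasurable c (ae_of_all _ hc)

/-- Dual functions to all B-splines that live on a knot span, where the monomials are
`u ^ r = ∑ⱼ B r j * bⱼ`. With `e s` dual to the monomials, `A j s = ∫ e s * bⱼ` satisfies
`B * A = 1`, hence `A * B = 1`, that is, `∑ₛ B s k * e s` is dual to `b_k`. -/
theorem exists_dual_on_span (p : ℕ) {α : ℝ} (hα : 0 < α) :
    ∃ G : ℝ, 0 ≤ G ∧ ∀ (m : ℕ) (Ξ : OpenKnotVector p m) (h : ℝ),
      (∀ i, i < m + p → Ξ.knot (i + 1) - Ξ.knot i ≤ h) →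
      ∀ q k : ℕ, k ≤ p → q + p < m → Ξ.knot (q + p) < Ξ.knot (q + p + 1) →
        α * h ≤ Ξ.knot (q + p + 1) - Ξ.knot (q + p) →
        ∃ φ : ℝ → ℝ, Measurable φ ∧
          (∀ x, |φ x| ≤ (Set.Ico (Ξ.knot (q + p)) (Ξ.knot (q + p + 1))).indicator
            (fun _ => G / (Ξ.knot (q + p + 1) - Ξ.knot (q + p))) x) ∧
          ∀ j, j < m → ∫ x in Set.Ioo (0 : ℝ) 1, φ x * bspline Ξ.knot p j x =
            if q + k = j then 1 else 0 := by
  classical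
  obtain ⟨η, hηc, hη⟩ := exists_dual_monomials (p + 1)
  obtain ⟨C, hC⟩ : ∃ C : ℝ, ∀ s, ∀ u ∈ Set.Icc (0 : ℝ) 1, |η s u| ≤ C := by
    have hs : ∀ s, ∃ C : ℝ, ∀ u ∈ Set.Icc (0 : ℝ) 1, |η s u| ≤ C := fun s =>
      isCompact_Icc.exists_bound_of_continuousOn (hηc s).continuousOn
    choose C hC using hs
    exact ⟨∑ s, |C s|, fun s u hu => (hC s u hu).trans ((le_abs_self _).trans
      (Finset.single_le_sum (f := fun s => |C s|) (fun _ _ => abs_nonneg _)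
        (Finset.mem_univ s)))⟩
  have hC0 : 0 ≤ C := (abs_nonneg _).trans (hC 0 0 (by simp))
  refine ⟨∑ _s : Fin (p + 1), (1 + p / α) ^ p * C, by positivity, ?_⟩
  intro m Ξ h hub q k hk hq hspan hlb
  obtain ⟨B, hB, hBb⟩ := exists_monomial_eq_sum_bspline hα Ξ hub hq hspan hlb
  set t := Ξ.knot with ht
  set a := t (q + p) with ha
  set b := t (q + p + 1) with hb
  set H := b - a with hH
  have hHpos : 0 < H := sub_pos.2 hspan
  let e : Fin (p + 1) → ℝ → ℝ := fun s =>
    (Set.Ico a b).indicator fun x => H⁻¹ * η s ((x - a) / H)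
  have hem : ∀ s, Measurable (e s) := fun s => by
    have := (hηc s).measurable
    exact Measurable.indicator (by fun_prop) measurableSet_Ico
  have heb : ∀ s x, |e s x| ≤ (Set.Ico a b).indicator (fun _ => H⁻¹ * C) x := by
    intro s x
    by_cases hx : x ∈ Set.Ico a b
    · simp only [e, Set.indicator_of_mem hx]
      rw [abs_mul, abs_of_pos (inv_pos.2 hHpos)]
      refine mul_le_mul_of_nonneg_left (hC s _ ⟨?_, ?_⟩) (inv_pos.2 hHpos).le
      · exact div_nonneg (by linarith [hx.1]) hHpos.le
      · exact div_le_one_of_le₀ (by linarith [hx.2]) hHpos.le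
    · simp only [e, Set.indicator_of_notMem hx, abs_zero, le_refl]
  have heb' : ∀ s x, |e s x| ≤ H⁻¹ * C := fun s x =>
    (heb s x).trans (Set.indicator_le_self' (fun _ _ => by positivity) x)
  -- the moments of the rescaled dual functions on the span
  have hmom : ∀ r s : Fin (p + 1),
      ∫ x in Set.Ioo (0 : ℝ) 1, e s x * ((x - a) / H) ^ (r : ℕ) = if r = s then 1 else 0 := by
    intro r s
    have h1 : ∀ x, e s x * ((x - a) / H) ^ (r : ℕ) = (Set.Ico a b).indicator
        (fun x => H⁻¹ * (((x - a) / H) ^ (r : ℕ) * η s ((x - a) / H))) x := by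
      intro x
      by_cases hx : x ∈ Set.Ico a b
      · simp only [e, Set.indicator_of_mem hx]; ring
      · simp only [e, Set.indicator_of_notMem hx, zero_mul]
    simp only [h1]
    have h2 : (volume.restrict (Set.Ioo (0 : ℝ) 1)).restrict (Set.Ico a b) =
        volume.restrict (Set.Ioc a b) := by
      rw [Measure.restrict_congr_set (Ioo_ae_eq_Icc (a := (0 : ℝ)) (b := 1)),
        Measure.restrict_restrict measurableSet_Ico, Set.inter_eq_left.2]
      · exact Measure.restrict_congr_set Ico_ae_eq_Ioc
      · exact Set.Ico_subset_Icc_self.trans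
          (Set.Icc_subset_Icc (Ξ.knot_mem_Icc (by omega)).1 (Ξ.knot_mem_Icc (by omega)).2)
    rw [integral_indicator measurableSet_Ico, h2, ← intervalIntegral.integral_of_le hspan.le,
      intervalIntegral.integral_const_mul, ← hη r s]
    have h4 : ∀ x, x / H - a / H = (x - a) / H := fun x => by ring
    have h5 := intervalIntegral.integral_comp_div_sub (a := a) (b := b)
      (fun u => u ^ (r : ℕ) * η s u) hHpos.ne' (a / H)
    simp only [h4] at h5
    rw [h5, sub_self, zero_div, ← hH, div_self hHpos.ne', smul_eq_mul,
      inv_mul_cancel_left₀ hHpos.ne']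
  have hbm := measurable_bspline t p
  have hbb : ∀ j, j < m → ∀ x, |bspline t p j x| ≤ 2 ^ p := fun j hj x => by
    have := bspline_mem_Icc Ξ.monotoneOn_knot p j x (by omega)
    rw [abs_of_nonneg this.1]
    exact this.2
  have hint : ∀ s j, j < m →
      IntegrableOn (fun x => e s x * bspline t p j x) (Set.Ioo (0 : ℝ) 1) := fun s j hj =>
    integrableOn_Ioo_of_bound ((hem s).mul (hbm j)) (c := H⁻¹ * C * 2 ^ p) fun x => by
      rw [abs_mul]
      exact mul_le_mul (heb' s x) (hbb j hj x) (abs_nonneg _) (by positivity)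
  let A : Matrix (Fin (p + 1)) (Fin (p + 1)) ℝ :=
    fun j s => ∫ x in Set.Ioo (0 : ℝ) 1, e s x * bspline t p (q + j) x
  have hBA : B * A = 1 := by
    ext r s
    rw [Matrix.mul_apply, Matrix.one_apply, ← hmom r s]
    simp only [A, ← integral_const_mul]
    rw [← integral_finsetSum _ fun j _ => (hint s _ (by omega)).const_mul _]
    refine integral_congr_ae (ae_of_all _ fun x => ?_)
    by_cases hx : x ∈ Set.Ico a b
    · simp only
      rw [← hBb x hx r, Finset.mul_sum]
      exact Finset.sum_congr rfl fun j _ => by ring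
    · simp [e, Set.indicator_of_notMem hx]
  have hAB : A * B = 1 := mul_eq_one_comm.1 hBA
  let k' : Fin (p + 1) := ⟨k, Nat.lt_succ_iff.2 hk⟩
  refine ⟨fun x => ∑ s, B s k' * e s x,
    Finset.measurable_sum _ fun s _ => (hem s).const_mul _, ?_, ?_⟩
  · intro x
    refine (Finset.abs_sum_le_sum_abs _ _).trans ?_
    by_cases hx : x ∈ Set.Ico a b
    · rw [Set.indicator_of_mem hx, div_eq_mul_inv, Finset.sum_mul]
      refine Finset.sum_le_sum fun s _ => ?_
      have := heb s x
      rw [Set.indicator_of_mem hx] at this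
      rw [abs_mul, mul_assoc, mul_comm C]
      exact mul_le_mul (hB s k') this (abs_nonneg _) (by positivity)
    · simp [e, Set.indicator_of_notMem hx]
  · intro j hj
    simp only [Finset.sum_mul, mul_assoc]
    rw [integral_finsetSum _ fun s _ => (hint s j hj).const_mul _]
    simp only [integral_const_mul]
    by_cases hj' : q ≤ j ∧ j ≤ q + p
    · obtain ⟨n, rfl⟩ := Nat.exists_eq_add_of_le hj'.1
      have h1 := congrFun (congrFun hAB ⟨n, by omega⟩) k'
      rw [Matrix.mul_apply, Matrix.one_apply] at h1
      have h2 : (q + k = q + n) ↔ ((⟨n, by omega⟩ : Fin (p + 1)) = k') := by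
        rw [Fin.ext_iff]; simp only [k']; omega
      simp only [h2]
      rw [← h1]
      exact Finset.sum_congr rfl fun s _ => mul_comm _ _
    · rw [if_neg (by omega)]
      refine Finset.sum_eq_zero fun s _ => ?_
      have h0 : ∀ x, e s x * bspline t p j x = 0 := by
        intro x
        by_cases hx : x ∈ Set.Ico a b
        · rw [bspline_eq_zero Ξ.monotoneOn_knot p j x (by omega), mul_zero]
          intro hxj
          rcases not_and_or.1 hj' with hlt | hlt
          · have := Ξ.knot_le (show j + p + 1 ≤ q + p by omega) (by omega)
            exact absurd (hxj.2.trans_le this) (not_lt.2 hx.1)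
          · have := Ξ.knot_le (show q + p + 1 ≤ j by omega) (by omega)
            exact absurd (this.trans hxj.1) (not_le.2 hx.2)
        · simp only [e, Set.indicator_of_notMem hx, zero_mul]
      simp [h0]

/-- Each B-spline has a dual function on its support whose `L²` norm is, up to a constant that
depends only on the degree and on the quasi-uniformity constant, the inverse of the norm of the
B-spline. -/
theorem exists_dual_bspline (p : ℕ) {α : ℝ} (hα : 0 < α) :
    ∃ K : ℝ, 0 ≤ K ∧ ∀ (m : ℕ) (Ξ : OpenKnotVector p m) (h : ℝ),
      (∀ i, i < m + p → Ξ.knot (i + 1) - Ξ.knot i ≤ h) →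
      (∀ i, i < m + p → Ξ.knot i < Ξ.knot (i + 1) → α * h ≤ Ξ.knot (i + 1) - Ξ.knot i) →
      ∀ i, i < m → ∃ φ : ℝ → ℝ, Measurable φ ∧ (∃ c, ∀ x, |φ x| ≤ c) ∧
        (∀ x, x ∉ Set.Ico (Ξ.knot i) (Ξ.knot (i + p + 1)) → φ x = 0) ∧
        (∀ j, j < m → ∫ x in Set.Ioo (0 : ℝ) 1, φ x * bspline Ξ.knot p j x =
            if i = j then 1 else 0) ∧
        (∫ x in Set.Ioo (0 : ℝ) 1, φ x ^ 2) *
          (∫ x in Set.Ioo (0 : ℝ) 1, bspline Ξ.knot p i x ^ 2) ≤ K := by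
  obtain ⟨G, hG, hdual⟩ := exists_dual_on_span p hα
  refine ⟨G ^ 2 * (2 ^ p) ^ 2 * ((p + 1 : ℕ) / α), by positivity, ?_⟩
  intro m Ξ h hub hlb i hi
  obtain ⟨l, hil, hlp, hspan⟩ := Ξ.exists_span hi
  obtain ⟨hpl, hlm⟩ := Ξ.index_of_span (by omega) hspan
  obtain ⟨q, rfl⟩ := Nat.exists_eq_add_of_le' hpl
  have hlb' := hlb _ (by omega) hspan
  have hh : 0 < h := by
    have := hub (q + p) (by omega)
    linarith
  obtain ⟨k, rfl⟩ := Nat.exists_eq_add_of_le (show q ≤ i by omega)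
  obtain ⟨φ, hφm, hφb, hφ⟩ := hdual m Ξ h hub q k (by omega) hlm hspan hlb'
  set H := Ξ.knot (q + p + 1) - Ξ.knot (q + p) with hH
  have hHpos : 0 < H := sub_pos.2 hspan
  refine ⟨φ, hφm, ⟨G / H, fun x =>
    (hφb x).trans (Set.indicator_le_self' (fun _ _ => by positivity) x)⟩, ?_, hφ, ?_⟩
  · intro x hx
    have h1 := hφb x
    rw [Set.indicator_of_notMem] at h1
    · exact abs_eq_zero.1 (le_antisymm h1 (abs_nonneg _))
    · exact fun h2 => hx ⟨(Ξ.knot_le hil (by omega)).trans h2.1,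
        h2.2.trans_le (Ξ.knot_le (by omega) (by omega))⟩
  · have h1 : ∫ x in Set.Ioo (0 : ℝ) 1, φ x ^ 2 ≤ (G / H) ^ 2 * H := by
      refine integral_le_of_le_indicator_Ico hspan.le (sq_nonneg _) (fun x => sq_nonneg _) ?_
      intro x
      have h2 := hφb x
      by_cases hx : x ∈ Set.Ico (Ξ.knot (q + p)) (Ξ.knot (q + p + 1))
      · rw [Set.indicator_of_mem hx] at h2 ⊢
        rw [← sq_abs]
        exact pow_le_pow_left₀ (abs_nonneg _) h2 2
      · rw [Set.indicator_of_notMem hx] at h2 ⊢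
        rw [abs_eq_zero.1 (le_antisymm h2 (abs_nonneg _))]
        simp
    have h3 : ∫ x in Set.Ioo (0 : ℝ) 1, bspline Ξ.knot p (q + k) x ^ 2 ≤
        (2 ^ p) ^ 2 * (Ξ.knot (q + k + p + 1) - Ξ.knot (q + k)) := by
      refine integral_le_of_le_indicator_Ico (Ξ.knot_lt_of_lt hi).le (sq_nonneg _)
        (fun x => sq_nonneg _) ?_
      intro x
      by_cases hx : x ∈ Set.Ico (Ξ.knot (q + k)) (Ξ.knot (q + k + p + 1))
      · rw [Set.indicator_of_mem hx]
        have := bspline_mem_Icc Ξ.monotoneOn_knot p (q + k) x (by omega)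
        exact pow_le_pow_left₀ this.1 this.2 2
      · rw [Set.indicator_of_notMem hx,
          bspline_eq_zero Ξ.monotoneOn_knot p (q + k) x (by omega) hx]
        simp
    have h4 := Ξ.knot_sub_le hub (q + k) (p + 1) (by omega)
    rw [← add_assoc] at h4
    have h5 : h ≤ H / α := by rw [le_div_iff₀ hα, mul_comm]; exact hlb'
    calc _ ≤ (G / H) ^ 2 * H * ((2 ^ p) ^ 2 * ((p + 1 : ℕ) * (H / α))) := by
          refine mul_le_mul h1 (h3.trans ?_) (integral_nonneg fun x => sq_nonneg _)
            (by positivity)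
          refine mul_le_mul_of_nonneg_left (h4.trans ?_) (by positivity)
          exact mul_le_mul_of_nonneg_left h5 (by positivity)
      _ = _ := by field_simp

/-! ### Tensor-product B-splines and their dual functions -/

/-- Lebesgue measure on the open unit cube. -/
noncomputable abbrev cubeMeasure (d : ℕ) : Measure (Fin d → ℝ) :=
  volume.restrict (Set.univ.pi fun _ => Set.Ioo (0 : ℝ) 1)

theorem cubeMeasure_eq_pi (d : ℕ) :
    cubeMeasure d = Measure.pi fun _ => volume.restrict (Set.Ioo (0 : ℝ) 1) := by
  rw [cubeMeasure, volume_pi, Measure.restrict_pi_pi]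

instance isFiniteMeasure_cubeMeasure (d : ℕ) : IsFiniteMeasure (cubeMeasure d) := by
  rw [cubeMeasure_eq_pi]
  infer_instance

theorem integral_cubeMeasure_prod {d : ℕ} (f : Fin d → ℝ → ℝ) :
    ∫ x, ∏ k, f k (x k) ∂cubeMeasure d = ∏ k, ∫ s in Set.Ioo (0 : ℝ) 1, f k s := by
  rw [cubeMeasure_eq_pi]
  exact integral_fintype_prod_eq_prod f

theorem ae_cubeMeasure_mem_Icc (d : ℕ) :
    ∀ᵐ x ∂cubeMeasure d, x ∈ Set.Icc (0 : Fin d → ℝ) 1 := by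
  filter_upwards [ae_restrict_mem (MeasurableSet.univ_pi fun _ => measurableSet_Ioo)] with x hx
  rw [Set.mem_univ_pi] at hx
  exact ⟨fun k => (hx k).1.le, fun k => (hx k).2.le⟩

/-- The Cauchy–Schwarz inequality for integrals of real functions. -/
theorem sq_integral_mul_le {X : Type*} [MeasurableSpace X] {μ : Measure X} {f g : X → ℝ}
    (hf : Integrable (fun x => f x ^ 2) μ) (hg : Integrable (fun x => g x ^ 2) μ)
    (hfg : Integrable (fun x => f x * g x) μ) :
    (∫ x, f x * g x ∂μ) ^ 2 ≤ (∫ x, f x ^ 2 ∂μ) * ∫ x, g x ^ 2 ∂μ := by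
  have key : ∀ s : ℝ, 0 ≤ (∫ x, f x ^ 2 ∂μ) * (s * s) + (2 * ∫ x, f x * g x ∂μ) * s +
      ∫ x, g x ^ 2 ∂μ := by
    intro s
    have h : ∫ x, (s * f x + g x) ^ 2 ∂μ = (∫ x, f x ^ 2 ∂μ) * (s * s) +
        (2 * ∫ x, f x * g x ∂μ) * s + ∫ x, g x ^ 2 ∂μ := by
      have e : ∀ x, (s * f x + g x) ^ 2 = s * s * f x ^ 2 + 2 * s * (f x * g x) + g x ^ 2 :=
        fun x => by ring
      simp only [e]
      have h1 : Integrable (fun x => s * s * f x ^ 2 + 2 * s * (f x * g x)) μ :=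
        (hf.const_mul _).add (hfg.const_mul _)
      rw [integral_add h1 hg, integral_add (hf.const_mul _) (hfg.const_mul _),
        integral_const_mul, integral_const_mul]
      ring
    rw [← h]
    exact integral_nonneg fun x => sq_nonneg _
  have := discrim_le_zero key
  rw [discrim] at this
  nlinarith

variable {d p m : ℕ}

/-- The product of the half-open intervals on which the univariate factors of a tensor-product
B-spline live. -/
def supportBox (Ξ : Fin d → OpenKnotVector p m) (i : Fin d → Fin m) : Set (Fin d → ℝ) :=
  Set.univ.pi fun k => Set.Ico ((Ξ k).knot (i k)) ((Ξ k).knot (i k + p + 1))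

theorem measurableSet_supportBox (Ξ : Fin d → OpenKnotVector p m) (i : Fin d → Fin m) :
    MeasurableSet (supportBox Ξ i) :=
  MeasurableSet.univ_pi fun _ => measurableSet_Ico

theorem tensorBSpline_eq_zero (Ξ : Fin d → OpenKnotVector p m) {i : Fin d → Fin m}
    {x : Fin d → ℝ} (hx : x ∉ supportBox Ξ i) : tensorBSpline Ξ i x = 0 := by
  simp only [supportBox, Set.mem_univ_pi, not_forall] at hx
  obtain ⟨k, hk⟩ := hx
  exact Finset.prod_eq_zero (Finset.mem_univ k)
    (bspline_eq_zero (Ξ k).monotoneOn_knot p _ _ (by omega) hk)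

theorem tensorBSpline_nonneg (Ξ : Fin d → OpenKnotVector p m) (i : Fin d → Fin m)
    (x : Fin d → ℝ) : 0 ≤ tensorBSpline Ξ i x :=
  Finset.prod_nonneg fun k _ => (bspline_mem_Icc (Ξ k).monotoneOn_knot p _ _ (by omega)).1

theorem tensorBSpline_le (Ξ : Fin d → OpenKnotVector p m) (i : Fin d → Fin m)
    (x : Fin d → ℝ) : tensorBSpline Ξ i x ≤ (2 ^ p) ^ d := by
  have h : ∀ k, bspline (Ξ k).knot p (i k) (x k) ∈ Set.Icc (0 : ℝ) (2 ^ p) := fun k =>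
    bspline_mem_Icc (Ξ k).monotoneOn_knot p _ _ (by omega)
  simpa [tensorBSpline] using
    Finset.prod_le_prod (s := Finset.univ) (fun k _ => (h k).1) fun k _ => (h k).2

@[fun_prop]
theorem measurable_tensorBSpline (Ξ : Fin d → OpenKnotVector p m) (i : Fin d → Fin m) :
    Measurable (tensorBSpline Ξ i) :=
  Finset.measurable_fun_prod _ fun k _ =>
    (measurable_bspline _ _ _).comp (measurable_pi_apply k)

theorem card_filter_mem_Ico_le (Ξ : OpenKnotVector p m) (y : ℝ) :
    (Finset.univ.filter fun i : Fin m =>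
      y ∈ Set.Ico (Ξ.knot i) (Ξ.knot (i + p + 1))).card ≤ p + 1 := by
  rcases Finset.eq_empty_or_nonempty (Finset.univ.filter fun i : Fin m =>
    y ∈ Set.Ico (Ξ.knot i) (Ξ.knot (i + p + 1))) with h | h
  · rw [h]
    simp
  · -- all these indices are within `p` of the smallest one
    have hmin := Finset.min'_mem _ h
    set i₀ := Finset.min' _ h with hi₀
    rw [Finset.mem_filter] at hmin
    calc _ ≤ (Finset.Icc (i₀ : ℕ) (i₀ + p)).card := by
          refine Finset.card_le_card_of_injOn (fun i => (i : ℕ)) ?_ (Fin.val_injective.injOn)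
          intro i hi
          have h1 : i₀ ≤ i := Finset.min'_le _ _ hi
          have h2 := (Finset.mem_filter.1 (Finset.mem_coe.1 hi)).2
          refine Finset.mem_coe.2 (Finset.mem_Icc.2 ⟨h1, ?_⟩)
          by_contra h3
          have h4 := Ξ.knot_le (show (i₀ : ℕ) + p + 1 ≤ i by simp only at h3; omega) (by omega)
          exact absurd (h4.trans h2.1) (not_le.2 hmin.2.2)
      _ = p + 1 := by simp; omega

open scoped Classical in
theorem card_filter_mem_supportBox_le (Ξ : Fin d → OpenKnotVector p m) (x : Fin d → ℝ) :
    (Finset.univ.filter fun i => x ∈ supportBox Ξ i).card ≤ (p + 1) ^ d := by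
  calc _ ≤ (Fintype.piFinset fun k => Finset.univ.filter fun i : Fin m =>
          x k ∈ Set.Ico ((Ξ k).knot i) ((Ξ k).knot (i + p + 1))).card := by
        refine Finset.card_le_card fun i hi => ?_
        rw [Fintype.mem_piFinset]
        exact fun k => Finset.mem_filter.2
          ⟨Finset.mem_univ _, (Finset.mem_filter.1 hi).2 k (Set.mem_univ k)⟩
    _ ≤ (p + 1) ^ d := by
        rw [Fintype.card_piFinset]
        simpa using Finset.prod_le_prod' (s := Finset.univ)
          fun k _ => card_filter_mem_Ico_le (Ξ k) (x k)

theorem parametricMass_apply_self (Ξ : Fin d → OpenKnotVector p m) (i : Fin d → Fin m) :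
    parametricMass Ξ i i = ∫ x, tensorBSpline Ξ i x ^ 2 ∂cubeMeasure d := by
  simp only [parametricMass, massMatrix, Matrix.of_apply, mul_one, sq]

theorem integrable_of_bound_cube {f : (Fin d → ℝ) → ℝ} (hf : Measurable f) {c : ℝ}
    (hc : ∀ x, |f x| ≤ c) : Integrable f (cubeMeasure d) :=
  Integrable.of_bound hf.aestronglyMeasurable c (ae_of_all _ hc)

/-- `L²` stability of tensor-product B-splines. The coefficient of a spline `s` is the integral of
`s` against a tensor product of univariate dual functions, so it is controlled by `s` on a support
box; at most `(p + 1) ^ d` of these boxes overlap. -/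
theorem exists_stability_const (d p : ℕ) {α : ℝ} (hα : 0 < α) :
    ∃ L : ℝ, 0 < L ∧ ∀ (m : ℕ) (Ξ : Fin d → OpenKnotVector p m) (h : ℝ),
      (∀ k i, i < m + p → (Ξ k).knot (i + 1) - (Ξ k).knot i ≤ h) →
      (∀ k i, i < m + p → (Ξ k).knot i < (Ξ k).knot (i + 1) →
        α * h ≤ (Ξ k).knot (i + 1) - (Ξ k).knot i) →
      (∀ i, 0 < parametricMass Ξ i i) ∧
      ∀ c : (Fin d → Fin m) → ℝ, ∑ i, c i ^ 2 * parametricMass Ξ i i ≤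
        L * ∫ x, (∑ i, c i * tensorBSpline Ξ i x) ^ 2 ∂cubeMeasure d := by
  classical
  obtain ⟨K, hK, hdual⟩ := exists_dual_bspline p hα
  refine ⟨K ^ d * (p + 1) ^ d + 1, by positivity, ?_⟩
  intro m Ξ h hub hlb
  have hd : ∀ k (i : Fin m), _ := fun k i => hdual m (Ξ k) h (hub k) (hlb k) i i.2
  choose φ hφm hφb hφ0 hφδ hφK using hd
  choose cb hcb using hφb
  let Φ : (Fin d → Fin m) → (Fin d → ℝ) → ℝ := fun i x => ∏ k, φ k (i k) (x k)
  have hΦm : ∀ i, Measurable (Φ i) := fun i =>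
    Finset.measurable_fun_prod _ fun k _ => (hφm k (i k)).comp (measurable_pi_apply k)
  have hΦb : ∀ i x, |Φ i x| ≤ ∏ k, cb k (i k) := fun i x => by
    rw [Finset.abs_prod]
    exact Finset.prod_le_prod (fun _ _ => abs_nonneg _) fun k _ => hcb _ _ _
  have hΦ0 : ∀ i x, x ∉ supportBox Ξ i → Φ i x = 0 := by
    intro i x hx
    simp only [supportBox, Set.mem_univ_pi, not_forall] at hx
    obtain ⟨k, hk⟩ := hx
    exact Finset.prod_eq_zero (Finset.mem_univ k) (hφ0 k (i k) _ hk)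
  have hΦδ : ∀ i j, ∫ x, Φ i x * tensorBSpline Ξ j x ∂cubeMeasure d = if i = j then 1 else 0 := by
    intro i j
    simp only [Φ, tensorBSpline, ← Finset.prod_mul_distrib]
    rw [integral_cubeMeasure_prod fun k s => φ k (i k) s * bspline (Ξ k).knot p (j k) s]
    simp only [fun k => hφδ k (i k) (j k) (j k).2, Fin.val_inj]
    by_cases hij : i = j
    · simp [hij]
    · rw [if_neg hij]
      obtain ⟨k, hk⟩ := Function.ne_iff.1 hij
      exact Finset.prod_eq_zero (Finset.mem_univ k) (if_neg hk)
  have hΦK : ∀ i, (∫ x, Φ i x ^ 2 ∂cubeMeasure d) * parametricMass Ξ i i ≤ K ^ d := by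
    intro i
    simp only [parametricMass_apply, Φ, ← Finset.prod_pow]
    rw [integral_cubeMeasure_prod fun k s => φ k (i k) s ^ 2, ← Finset.prod_mul_distrib]
    simp only [← sq]
    simpa using Finset.prod_le_prod (s := Finset.univ) (fun k _ => mul_nonneg
      (integral_nonneg fun x => sq_nonneg (φ k (i k) x))
      (integral_nonneg fun x => sq_nonneg (bspline (Ξ k).knot p (i k) x)))
      fun k _ => hφK k (i k)
  have hΦ2 : ∀ i, Integrable (fun x => Φ i x ^ 2) (cubeMeasure d) := fun i =>
    integrable_of_bound_cube ((hΦm i).pow_const 2) (c := (∏ k, cb k (i k)) ^ 2) fun x => by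
      rw [abs_pow]
      exact pow_le_pow_left₀ (abs_nonneg _) (hΦb i x) 2
  have hBabs : ∀ i x, |tensorBSpline Ξ i x| ≤ (2 ^ p) ^ d := fun i x => by
    rw [abs_of_nonneg (tensorBSpline_nonneg Ξ i x)]
    exact tensorBSpline_le Ξ i x
  have hΦB : ∀ i j, Integrable (fun x => Φ i x * tensorBSpline Ξ j x) (cubeMeasure d) := fun i j =>
    integrable_of_bound_cube ((hΦm i).mul (measurable_tensorBSpline Ξ j))
      (c := (∏ k, cb k (i k)) * (2 ^ p) ^ d) fun x => by
      rw [abs_mul]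
      exact mul_le_mul (hΦb i x) (hBabs j x) (abs_nonneg _) ((abs_nonneg _).trans (hΦb i x))
  constructor
  · intro i
    have h1 := sq_integral_mul_le (hΦ2 i) (g := tensorBSpline Ξ i)
      (integrable_of_bound_cube ((measurable_tensorBSpline Ξ i).pow_const 2)
        (c := ((2 ^ p) ^ d) ^ 2) fun x => by
          rw [abs_pow]
          exact pow_le_pow_left₀ (abs_nonneg _) (hBabs i x) 2) (hΦB i i)
    rw [hΦδ, if_pos rfl, one_pow, ← parametricMass_apply_self] at h1
    exact pos_of_mul_pos_right (zero_lt_one.trans_le h1) (integral_nonneg fun x => sq_nonneg _)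
  · intro c
    let s : (Fin d → ℝ) → ℝ := fun x => ∑ i, c i * tensorBSpline Ξ i x
    have hsm : Measurable s := by fun_prop
    have hsb : ∀ x, |s x| ≤ ∑ i, |c i| * (2 ^ p) ^ d := fun x => by
      refine (Finset.abs_sum_le_sum_abs _ _).trans (Finset.sum_le_sum fun i _ => ?_)
      rw [abs_mul]
      exact mul_le_mul_of_nonneg_left (hBabs i x) (abs_nonneg _)
    have hs2 : Integrable (fun x => s x ^ 2) (cubeMeasure d) :=
      integrable_of_bound_cube (hsm.pow_const 2) (c := (∑ i, |c i| * (2 ^ p) ^ d) ^ 2) fun x => by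
        rw [abs_pow]
        exact pow_le_pow_left₀ (abs_nonneg _) (hsb x) 2
    have hind : ∀ i, Integrable ((supportBox Ξ i).indicator fun x => s x ^ 2) (cubeMeasure d) :=
      fun i => hs2.indicator (measurableSet_supportBox Ξ i)
    have hcoef : ∀ i, c i ^ 2 ≤ (∫ x, Φ i x ^ 2 ∂cubeMeasure d) *
        ∫ x, (supportBox Ξ i).indicator (fun x => s x ^ 2) x ∂cubeMeasure d := by
      intro i
      have e1 : ∀ x, Φ i x * (supportBox Ξ i).indicator s x =
          ∑ j, c j * (Φ i x * tensorBSpline Ξ j x) := by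
        intro x
        by_cases hx : x ∈ supportBox Ξ i
        · rw [Set.indicator_of_mem hx, Finset.mul_sum]
          exact Finset.sum_congr rfl fun j _ => by ring
        · simp [hΦ0 i x hx]
      have e2 : ∀ x, (supportBox Ξ i).indicator s x ^ 2 =
          (supportBox Ξ i).indicator (fun x => s x ^ 2) x := by
        intro x
        by_cases hx : x ∈ supportBox Ξ i <;> simp [hx]
      have h1 := sq_integral_mul_le (hΦ2 i) (g := (supportBox Ξ i).indicator s)
        (by simpa only [e2] using hind i)
        (by simpa only [e1] using integrable_finsetSum _ fun j _ => (hΦB i j).const_mul (c j))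
      simp only [e1, e2] at h1
      rw [integral_finsetSum _ fun j _ => (hΦB i j).const_mul (c j)] at h1
      simpa [integral_const_mul, hΦδ] using h1
    have hs0 : 0 ≤ ∫ x, s x ^ 2 ∂cubeMeasure d := integral_nonneg fun x => sq_nonneg _
    have hM0 : ∀ i, 0 ≤ parametricMass Ξ i i := fun i => by
      rw [parametricMass_apply_self]
      exact integral_nonneg fun x => sq_nonneg _
    calc ∑ i, c i ^ 2 * parametricMass Ξ i i
        ≤ ∑ i, K ^ d * ∫ x, (supportBox Ξ i).indicator (fun x => s x ^ 2) x ∂cubeMeasure d := by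
          refine Finset.sum_le_sum fun i _ => ?_
          refine (mul_le_mul_of_nonneg_right (hcoef i) (hM0 i)).trans ?_
          rw [mul_right_comm]
          exact mul_le_mul_of_nonneg_right (hΦK i)
            (integral_nonneg fun x => Set.indicator_nonneg (fun _ _ => sq_nonneg _) x)
      _ = K ^ d * ∫ x, ∑ i, (supportBox Ξ i).indicator (fun x => s x ^ 2) x ∂cubeMeasure d := by
          rw [← Finset.mul_sum, integral_finsetSum _ fun i _ => hind i]
      _ ≤ K ^ d * ∫ x, (p + 1) ^ d * s x ^ 2 ∂cubeMeasure d := by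
          refine mul_le_mul_of_nonneg_left (integral_mono (integrable_finsetSum _ fun i _ => hind i)
            (hs2.const_mul _) fun x => ?_) (by positivity)
          simp only [Set.indicator_apply, ← Finset.sum_filter, Finset.sum_const, nsmul_eq_mul]
          refine mul_le_mul_of_nonneg_right ?_ (sq_nonneg _)
          exact_mod_cast card_filter_mem_supportBox_le Ξ x
      _ ≤ _ := by
          rw [integral_const_mul, add_mul, ← mul_assoc]
          linarith

/-! ### Quadratic forms of the mass matrix and of the preconditioner -/

theorem integrable_tensor_mul_weight (Ξ : Fin d → OpenKnotVector p m) {ω : (Fin d → ℝ) → ℝ}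
    (hω : Integrable ω (cubeMeasure d)) (i j : Fin d → Fin m) :
    Integrable (fun x => tensorBSpline Ξ i x * tensorBSpline Ξ j x * ω x) (cubeMeasure d) := by
  refine hω.bdd_mul (c := (2 ^ p) ^ d * (2 ^ p) ^ d)
    ((measurable_tensorBSpline Ξ i).mul (measurable_tensorBSpline Ξ j)).aestronglyMeasurable
    (ae_of_all _ fun x => ?_)
  rw [Real.norm_eq_abs, abs_of_nonneg
    (mul_nonneg (tensorBSpline_nonneg Ξ i x) (tensorBSpline_nonneg Ξ j x))]
  exact mul_le_mul (tensorBSpline_le Ξ i x) (tensorBSpline_le Ξ j x)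
    (tensorBSpline_nonneg Ξ j x) (by positivity)

theorem sq_sum_mul_weight_eq (Ξ : Fin d → OpenKnotVector p m) (ω : (Fin d → ℝ) → ℝ)
    (c : (Fin d → Fin m) → ℝ) (x : Fin d → ℝ) :
    (∑ i, c i * tensorBSpline Ξ i x) ^ 2 * ω x =
      ∑ i, ∑ j, c i * c j * (tensorBSpline Ξ i x * tensorBSpline Ξ j x * ω x) := by
  rw [sq, Finset.sum_mul_sum, Finset.sum_mul]
  refine Finset.sum_congr rfl fun i _ => ?_
  rw [Finset.sum_mul]
  exact Finset.sum_congr rfl fun j _ => by ring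

theorem integrable_sq_sum_mul_weight (Ξ : Fin d → OpenKnotVector p m) {ω : (Fin d → ℝ) → ℝ}
    (hω : Integrable ω (cubeMeasure d)) (c : (Fin d → Fin m) → ℝ) :
    Integrable (fun x => (∑ i, c i * tensorBSpline Ξ i x) ^ 2 * ω x) (cubeMeasure d) := by
  simp only [sq_sum_mul_weight_eq]
  exact integrable_finsetSum _ fun i _ => integrable_finsetSum _ fun j _ =>
    (integrable_tensor_mul_weight Ξ hω i j).const_mul _

theorem dotProduct_mulVec_eq_sum {n : Type*} [Fintype n] (A : Matrix n n ℝ) (c : n → ℝ) :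
    c ⬝ᵥ A.mulVec c = ∑ i, ∑ j, c i * c j * A i j := by
  simp only [dotProduct, Matrix.mulVec, Finset.mul_sum]
  exact Finset.sum_congr rfl fun i _ => Finset.sum_congr rfl fun j _ => by ring

theorem dotProduct_massMatrix_mulVec (Ξ : Fin d → OpenKnotVector p m) {ω : (Fin d → ℝ) → ℝ}
    (hω : Integrable ω (cubeMeasure d)) (c : (Fin d → Fin m) → ℝ) :
    c ⬝ᵥ (massMatrix Ξ ω).mulVec c =
      ∫ x, (∑ i, c i * tensorBSpline Ξ i x) ^ 2 * ω x ∂cubeMeasure d := by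
  simp only [sq_sum_mul_weight_eq]
  rw [integral_finsetSum _ fun i _ => integrable_finsetSum _ fun j _ =>
    (integrable_tensor_mul_weight Ξ hω i j).const_mul _, dotProduct_mulVec_eq_sum]
  refine Finset.sum_congr rfl fun i _ => ?_
  rw [integral_finsetSum _ fun j _ => (integrable_tensor_mul_weight Ξ hω i j).const_mul _]
  simp only [integral_const_mul]
  rfl

theorem dotProduct_parametricMass_mulVec (Ξ : Fin d → OpenKnotVector p m)
    (c : (Fin d → Fin m) → ℝ) :
    c ⬝ᵥ (parametricMass Ξ).mulVec c =
      ∫ x, (∑ i, c i * tensorBSpline Ξ i x) ^ 2 ∂cubeMeasure d := by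
  simpa [parametricMass] using dotProduct_massMatrix_mulVec Ξ (integrable_const (1 : ℝ)) c

theorem massMatrix_isHermitian (Ξ : Fin d → OpenKnotVector p m) (ω : (Fin d → ℝ) → ℝ) :
    (massMatrix Ξ ω).IsHermitian := by
  ext i j
  simp only [Matrix.conjTranspose_apply, massMatrix, Matrix.of_apply, star_trivial]
  exact integral_congr_ae (ae_of_all _ fun x => by simp only; ring)

/-- The diagonal of `D^{1/2} D̂^{-1/2}`: the square root of the mean of the weight against the
square of a B-spline. -/
noncomputable def weightFactor (Ξ : Fin d → OpenKnotVector p m) (ω : (Fin d → ℝ) → ℝ)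
    (i : Fin d → Fin m) : ℝ :=
  √(massMatrix Ξ ω i i) * (√(parametricMass Ξ i i))⁻¹

theorem weightFactor_nonneg (Ξ : Fin d → OpenKnotVector p m) (ω : (Fin d → ℝ) → ℝ)
    (i : Fin d → Fin m) : 0 ≤ weightFactor Ξ ω i := by
  unfold weightFactor
  positivity

theorem preconditioner_apply (Ξ : Fin d → OpenKnotVector p m) (ω : (Fin d → ℝ) → ℝ)
    (i j : Fin d → Fin m) :
    preconditioner Ξ ω i j = weightFactor Ξ ω i * weightFactor Ξ ω j * parametricMass Ξ i j := by
  simp only [preconditioner, Matrix.mul_diagonal, Matrix.diagonal_mul_diagonal,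
    Matrix.diagonal_mul, weightFactor]
  ring

theorem preconditioner_isHermitian (Ξ : Fin d → OpenKnotVector p m) (ω : (Fin d → ℝ) → ℝ) :
    (preconditioner Ξ ω).IsHermitian := by
  ext i j
  have h := (massMatrix_isHermitian Ξ fun _ => 1).apply i j
  rw [Matrix.conjTranspose_apply, star_trivial, preconditioner_apply, preconditioner_apply]
  rw [star_trivial] at h
  rw [show parametricMass Ξ j i = parametricMass Ξ i j from h]
  ring

theorem dotProduct_preconditioner_mulVec (Ξ : Fin d → OpenKnotVector p m)
    (ω : (Fin d → ℝ) → ℝ) (c : (Fin d → Fin m) → ℝ) :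
    c ⬝ᵥ (preconditioner Ξ ω).mulVec c =
      (fun i => weightFactor Ξ ω i * c i) ⬝ᵥ
        (parametricMass Ξ).mulVec fun i => weightFactor Ξ ω i * c i := by
  simp only [dotProduct_mulVec_eq_sum, preconditioner_apply]
  exact Finset.sum_congr rfl fun i _ => Finset.sum_congr rfl fun j _ => by ring

section Bounds

variable {Ξ : Fin d → OpenKnotVector p m} {ω : (Fin d → ℝ) → ℝ}

theorem mul_parametricMass_le_massMatrix (hω : Integrable ω (cubeMeasure d)) {w : ℝ}
    (hw : ∀ x ∈ Set.Icc (0 : Fin d → ℝ) 1, w ≤ ω x) (i : Fin d → Fin m) :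
    w * parametricMass Ξ i i ≤ massMatrix Ξ ω i i := by
  simp only [parametricMass, massMatrix, Matrix.of_apply]
  rw [← integral_const_mul]
  refine integral_mono_ae ((integrable_tensor_mul_weight Ξ (integrable_const 1) i i).const_mul w)
    (integrable_tensor_mul_weight Ξ hω i i) ?_
  filter_upwards [ae_cubeMeasure_mem_Icc d] with x hx
  rw [mul_one, mul_comm]
  exact mul_le_mul_of_nonneg_left (hw x hx) (mul_self_nonneg _)

theorem sq_weightFactor (hω : Integrable ω (cubeMeasure d))
    (hω0 : ∀ x ∈ Set.Icc (0 : Fin d → ℝ) 1, 0 ≤ ω x) {i : Fin d → Fin m}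
    (hi : 0 < parametricMass Ξ i i) :
    weightFactor Ξ ω i ^ 2 * parametricMass Ξ i i = massMatrix Ξ ω i i := by
  have h := mul_parametricMass_le_massMatrix (Ξ := Ξ) hω hω0 i
  rw [zero_mul] at h
  rw [weightFactor, mul_pow, inv_pow, Real.sq_sqrt h, Real.sq_sqrt hi.le,
    inv_mul_cancel_right₀ hi.ne']

theorem abs_sq_weightFactor_sub_le (hω : Integrable ω (cubeMeasure d))
    (hω0 : ∀ x ∈ Set.Icc (0 : Fin d → ℝ) 1, 0 ≤ ω x) {i : Fin d → Fin m}
    (hi : 0 < parametricMass Ξ i i) {η : ℝ} {y : Fin d → ℝ}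
    (hosc : ∀ x ∈ supportBox Ξ i, x ∈ Set.Icc (0 : Fin d → ℝ) 1 → |ω x - ω y| ≤ η) :
    |weightFactor Ξ ω i ^ 2 - ω y| ≤ η := by
  have h1 : ∀ a : ℝ, a * parametricMass Ξ i i =
      ∫ x, a * (tensorBSpline Ξ i x * tensorBSpline Ξ i x * 1) ∂cubeMeasure d := fun a => by
    rw [integral_const_mul]
    rfl
  have hint := fun a : ℝ =>
    (integrable_tensor_mul_weight Ξ (integrable_const (1 : ℝ)) i i).const_mul a
  have hpt : ∀ᵐ x ∂cubeMeasure d,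
      (ω y - η) * (tensorBSpline Ξ i x * tensorBSpline Ξ i x * 1) ≤
        tensorBSpline Ξ i x * tensorBSpline Ξ i x * ω x ∧
      tensorBSpline Ξ i x * tensorBSpline Ξ i x * ω x ≤
        (ω y + η) * (tensorBSpline Ξ i x * tensorBSpline Ξ i x * 1) := by
    filter_upwards [ae_cubeMeasure_mem_Icc d] with x hx
    by_cases hxi : x ∈ supportBox Ξ i
    · have h2 := abs_le.1 (hosc x hxi hx)
      have h3 := mul_self_nonneg (tensorBSpline Ξ i x)
      constructor <;> nlinarith
    · simp [tensorBSpline_eq_zero Ξ hxi]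
  have hlo : (ω y - η) * parametricMass Ξ i i ≤ massMatrix Ξ ω i i := by
    rw [h1]
    exact integral_mono_ae (hint _) (integrable_tensor_mul_weight Ξ hω i i)
      (hpt.mono fun x hx => hx.1)
  have hhi : massMatrix Ξ ω i i ≤ (ω y + η) * parametricMass Ξ i i := by
    rw [h1]
    exact integral_mono_ae (integrable_tensor_mul_weight Ξ hω i i) (hint _)
      (hpt.mono fun x hx => hx.2)
  rw [← sq_weightFactor hω hω0 hi] at hlo hhi
  have h4 := le_of_mul_le_mul_right hlo hi
  have h5 := le_of_mul_le_mul_right hhi hi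
  exact abs_le.2 ⟨by linarith, by linarith⟩

/-- Where two B-splines are both nonzero, the weight is within its oscillation `η` over the support
boxes of the geometric mean of the two local averages. -/
theorem abs_massMatrix_sub_preconditioner_le (hω : Integrable ω (cubeMeasure d))
    (hω0 : ∀ x ∈ Set.Icc (0 : Fin d → ℝ) 1, 0 ≤ ω x)
    (hpos : ∀ i, 0 < parametricMass Ξ i i) {η : ℝ}
    (hosc : ∀ i, ∀ x ∈ supportBox Ξ i, x ∈ Set.Icc (0 : Fin d → ℝ) 1 →
      ∀ y ∈ supportBox Ξ i, y ∈ Set.Icc (0 : Fin d → ℝ) 1 → |ω x - ω y| ≤ η)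
    (i j : Fin d → Fin m) :
    |(massMatrix Ξ ω - preconditioner Ξ ω) i j| ≤ η * parametricMass Ξ i j := by
  set e := weightFactor Ξ ω with he
  have hint1 := integrable_tensor_mul_weight Ξ (integrable_const (1 : ℝ)) i j
  have hint := integrable_tensor_mul_weight Ξ hω i j
  have h1 : (massMatrix Ξ ω - preconditioner Ξ ω) i j = ∫ x,
      (tensorBSpline Ξ i x * tensorBSpline Ξ j x * ω x -
        e i * e j * (tensorBSpline Ξ i x * tensorBSpline Ξ j x * 1)) ∂cubeMeasure d := by
    rw [integral_sub hint (hint1.const_mul _), integral_const_mul, Matrix.sub_apply,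
      preconditioner_apply]
    rfl
  have h2 : η * parametricMass Ξ i j =
      ∫ x, η * (tensorBSpline Ξ i x * tensorBSpline Ξ j x * 1) ∂cubeMeasure d := by
    rw [integral_const_mul]
    rfl
  rw [h1, h2]
  refine abs_integral_le_integral_abs.trans (integral_mono_ae
    (hint.sub (hint1.const_mul _)).abs (hint1.const_mul _) ?_)
  filter_upwards [ae_cubeMeasure_mem_Icc d] with x hx
  by_cases hxi : x ∈ supportBox Ξ i
  · by_cases hxj : x ∈ supportBox Ξ j
    · have a1 := abs_le.1 (abs_sq_weightFactor_sub_le hω hω0 (hpos i)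
        fun y hy hy' => hosc i y hy hy' x hxi hx)
      have a2 := abs_le.1 (abs_sq_weightFactor_sub_le hω hω0 (hpos j)
        fun y hy hy' => hosc j y hy hy' x hxj hx)
      rw [← he] at a1 a2
      have e1 : 0 ≤ e i := weightFactor_nonneg Ξ ω i
      have e2 : 0 ≤ e j := weightFactor_nonneg Ξ ω j
      have b1 : |ω x - e i * e j| ≤ η := by
        rw [abs_le]
        constructor
        · nlinarith [sq_nonneg (e i - e j)]
        · -- the product is at least the smaller of the two squares
          rcases le_total (e i) (e j) with hle | hle <;> nlinarith
      have b2 := mul_nonneg (tensorBSpline_nonneg Ξ i x) (tensorBSpline_nonneg Ξ j x)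
      have b3 : tensorBSpline Ξ i x * tensorBSpline Ξ j x * ω x -
          e i * e j * (tensorBSpline Ξ i x * tensorBSpline Ξ j x * 1) =
          (ω x - e i * e j) * (tensorBSpline Ξ i x * tensorBSpline Ξ j x) := by ring
      rw [b3, abs_mul, abs_of_nonneg b2, mul_one]
      exact mul_le_mul_of_nonneg_right b1 b2
    · simp [tensorBSpline_eq_zero Ξ hxj]
  · simp [tensorBSpline_eq_zero Ξ hxi]

/-- At each point at most `(p + 1) ^ d` B-splines are nonzero, so the quadratic form of the
parametric mass matrix is bounded by that of its diagonal. -/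
theorem dotProduct_parametricMass_mulVec_le (Ξ : Fin d → OpenKnotVector p m)
    (c : (Fin d → Fin m) → ℝ) :
    c ⬝ᵥ (parametricMass Ξ).mulVec c ≤ (p + 1) ^ d * ∑ i, c i ^ 2 * parametricMass Ξ i i := by
  classical
  have hint1 := fun i => integrable_tensor_mul_weight Ξ (integrable_const (1 : ℝ)) i i
  have hint : Integrable (fun x => ∑ i, c i ^ 2 *
      (tensorBSpline Ξ i x * tensorBSpline Ξ i x * 1)) (cubeMeasure d) :=
    integrable_finsetSum _ fun i _ => (hint1 i).const_mul _
  have h1 : (p + 1) ^ d * ∑ i, c i ^ 2 * parametricMass Ξ i i =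
      ∫ x, ((p : ℝ) + 1) ^ d * ∑ i, c i ^ 2 *
        (tensorBSpline Ξ i x * tensorBSpline Ξ i x * 1) ∂cubeMeasure d := by
    rw [integral_const_mul, integral_finsetSum _ fun i _ => (hint1 i).const_mul _]
    simp only [integral_const_mul]
    rfl
  rw [h1, dotProduct_parametricMass_mulVec]
  have h2 := integrable_sq_sum_mul_weight Ξ (integrable_const (1 : ℝ)) c
  simp only [mul_one] at h2
  refine integral_mono h2 (hint.const_mul _) fun x => ?_
  set s := Finset.univ.filter fun i => x ∈ supportBox Ξ i with hs
  have h3 : ∑ i, c i * tensorBSpline Ξ i x = ∑ i ∈ s, c i * tensorBSpline Ξ i x := by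
    refine (Finset.sum_subset (Finset.subset_univ s) fun i _ hi => ?_).symm
    rw [tensorBSpline_eq_zero Ξ (by simpa [hs] using hi), mul_zero]
  simp only
  rw [h3]
  calc _ ≤ (s.card : ℝ) * ∑ i ∈ s, (c i * tensorBSpline Ξ i x) ^ 2 := sq_sum_le_card_mul_sum_sq
    _ ≤ (p + 1) ^ d * ∑ i ∈ s, (c i * tensorBSpline Ξ i x) ^ 2 := by
        refine mul_le_mul_of_nonneg_right ?_ (Finset.sum_nonneg fun i _ => sq_nonneg _)
        exact_mod_cast card_filter_mem_supportBox_le Ξ x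
    _ ≤ (p + 1) ^ d * ∑ i, (c i * tensorBSpline Ξ i x) ^ 2 := by
        refine mul_le_mul_of_nonneg_left ?_ (by positivity)
        exact Finset.sum_le_sum_of_subset_of_nonneg (Finset.subset_univ s)
          fun i _ _ => sq_nonneg _
    _ = _ := by
        congr 1
        exact Finset.sum_congr rfl fun i _ => by ring

theorem abs_dotProduct_sub_mulVec_le (hω : Integrable ω (cubeMeasure d))
    (hω0 : ∀ x ∈ Set.Icc (0 : Fin d → ℝ) 1, 0 ≤ ω x)
    (hpos : ∀ i, 0 < parametricMass Ξ i i) {η : ℝ} (hη : 0 ≤ η)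
    (hosc : ∀ i, ∀ x ∈ supportBox Ξ i, x ∈ Set.Icc (0 : Fin d → ℝ) 1 →
      ∀ y ∈ supportBox Ξ i, y ∈ Set.Icc (0 : Fin d → ℝ) 1 → |ω x - ω y| ≤ η)
    (c : (Fin d → Fin m) → ℝ) :
    |c ⬝ᵥ (massMatrix Ξ ω - preconditioner Ξ ω).mulVec c| ≤
      η * ((p + 1) ^ d * ∑ i, c i ^ 2 * parametricMass Ξ i i) := by
  have h := dotProduct_parametricMass_mulVec_le Ξ fun i => |c i|
  simp only [sq_abs] at h
  refine le_trans ?_ (mul_le_mul_of_nonneg_left h hη)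
  rw [dotProduct_mulVec_eq_sum, dotProduct_mulVec_eq_sum, Finset.mul_sum]
  refine (Finset.abs_sum_le_sum_abs _ _).trans (Finset.sum_le_sum fun i _ => ?_)
  rw [Finset.mul_sum]
  refine (Finset.abs_sum_le_sum_abs _ _).trans (Finset.sum_le_sum fun j _ => ?_)
  rw [abs_mul, abs_mul, mul_left_comm]
  exact mul_le_mul_of_nonneg_left
    (abs_massMatrix_sub_preconditioner_le hω hω0 hpos hosc i j) (by positivity)

/-- Lower bound for the form of `M` from the stability constant `L` and a lower bound `w` of the
weight. -/
theorem sum_le_dotProduct_massMatrix_mulVec (hω : Integrable ω (cubeMeasure d)) {w L : ℝ}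
    (hw0 : 0 ≤ w) (hw : ∀ x ∈ Set.Icc (0 : Fin d → ℝ) 1, w ≤ ω x)
    (hL : ∀ c : (Fin d → Fin m) → ℝ, ∑ i, c i ^ 2 * parametricMass Ξ i i ≤
      L * ∫ x, (∑ i, c i * tensorBSpline Ξ i x) ^ 2 ∂cubeMeasure d) (hL0 : 0 ≤ L)
    (c : (Fin d → Fin m) → ℝ) :
    w * ∑ i, c i ^ 2 * parametricMass Ξ i i ≤ L * (c ⬝ᵥ (massMatrix Ξ ω).mulVec c) := by
  refine (mul_le_mul_of_nonneg_left (hL c) hw0).trans ?_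
  rw [mul_left_comm, dotProduct_massMatrix_mulVec Ξ hω, ← integral_const_mul]
  refine mul_le_mul_of_nonneg_left ?_ hL0
  have h2 := integrable_sq_sum_mul_weight Ξ (integrable_const (1 : ℝ)) c
  simp only [mul_one] at h2
  refine integral_mono_ae (h2.const_mul w) (integrable_sq_sum_mul_weight Ξ hω c) ?_
  filter_upwards [ae_cubeMeasure_mem_Icc d] with x hx
  rw [mul_comm w]
  exact mul_le_mul_of_nonneg_left (hw x hx) (sq_nonneg _)

/-- The preconditioner has the same lower bound as the mass matrix: its form at `c` is that of the
parametric mass matrix at the coefficients `e i * c i`, and `e i ^ 2 ≥ w`. -/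
theorem sum_le_dotProduct_preconditioner_mulVec (hω : Integrable ω (cubeMeasure d)) {w L : ℝ}
    (hw0 : 0 ≤ w) (hw : ∀ x ∈ Set.Icc (0 : Fin d → ℝ) 1, w ≤ ω x)
    (hpos : ∀ i, 0 < parametricMass Ξ i i)
    (hL : ∀ c : (Fin d → Fin m) → ℝ, ∑ i, c i ^ 2 * parametricMass Ξ i i ≤
      L * ∫ x, (∑ i, c i * tensorBSpline Ξ i x) ^ 2 ∂cubeMeasure d)
    (c : (Fin d → Fin m) → ℝ) :
    w * ∑ i, c i ^ 2 * parametricMass Ξ i i ≤ L * (c ⬝ᵥ (preconditioner Ξ ω).mulVec c) := by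
  rw [dotProduct_preconditioner_mulVec, dotProduct_parametricMass_mulVec]
  refine le_trans ?_ (hL _)
  rw [Finset.mul_sum]
  refine Finset.sum_le_sum fun i _ => ?_
  rw [mul_pow, mul_right_comm, sq_weightFactor hω (fun x hx => hw0.trans (hw x hx)) (hpos i)]
  nlinarith [mul_parametricMass_le_massMatrix (Ξ := Ξ) hω hw i, sq_nonneg (c i)]

theorem posDef_of_sum_le {A : Matrix (Fin d → Fin m) (Fin d → Fin m) ℝ} (hA : A.IsHermitian)
    (hpos : ∀ i, 0 < parametricMass Ξ i i) {w L : ℝ} (hw : 0 < w) (hL : 0 < L)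
    (h : ∀ c, w * ∑ i, c i ^ 2 * parametricMass Ξ i i ≤ L * (c ⬝ᵥ A.mulVec c)) : A.PosDef := by
  refine Matrix.PosDef.of_dotProduct_mulVec_pos hA fun c hc => ?_
  obtain ⟨i, hi⟩ := Function.ne_iff.1 hc
  have hsum : 0 < ∑ i, c i ^ 2 * parametricMass Ξ i i :=
    Finset.sum_pos' (fun j _ => mul_nonneg (sq_nonneg _) (hpos j).le)
      ⟨i, Finset.mem_univ i, mul_pos (sq_pos_of_ne_zero hi) (hpos i)⟩
  have := (mul_pos hw hsum).trans_le (h c)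
  rw [star_trivial]
  exact pos_of_mul_pos_right this hL.le

end Bounds

/-! ### Mesh size and diameter of the supports -/

theorem knot_sub_le_meshSize (Ξ : Fin d → OpenKnotVector p m) (k : Fin d) {i : ℕ}
    (hi : i < m + p) : (Ξ k).knot (i + 1) - (Ξ k).knot i ≤ meshSize Ξ :=
  (le_abs_self _).trans (le_ciSup
    (f := fun q : Fin d × Fin (m + p) => |(Ξ q.1).knot (q.2 + 1) - (Ξ q.1).knot q.2|)
    (Set.finite_range _).bddAbove (k, ⟨i, hi⟩))

theorem exists_le_nonempty_span (Ξ : Fin d → OpenKnotVector p m) :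
    ∃ α : ℝ, 0 < α ∧ ∀ k i, i < m + p → (Ξ k).knot i < (Ξ k).knot (i + 1) →
      α ≤ (Ξ k).knot (i + 1) - (Ξ k).knot i := by
  let f : Fin d × Fin (m + p) → ℝ := fun q => (Ξ q.1).knot (q.2 + 1) - (Ξ q.1).knot q.2
  let g : Option (Fin d × Fin (m + p)) → ℝ := fun o => o.elim 1 fun q => if 0 < f q then f q else 1
  obtain ⟨o, ho⟩ := Finite.exists_min g
  refine ⟨g o, ?_, fun k i hi hlt => ?_⟩
  · cases o with
    | none => exact zero_lt_one
    | some q =>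
      simp only [g, Option.elim]
      split_ifs with h
      exacts [h, zero_lt_one]
  · refine (ho (some (k, ⟨i, hi⟩))).trans (le_of_eq ?_)
    simp only [g, Option.elim, f]
    rw [if_pos (sub_pos.2 hlt)]

theorem dist_lt_of_mem_supportBox (Ξ : Fin d → OpenKnotVector p m) {δ : ℝ} (hδ : 0 < δ)
    (hmesh : meshSize Ξ < δ / (p + 1)) {i : Fin d → Fin m} {x y : Fin d → ℝ}
    (hx : x ∈ supportBox Ξ i) (hy : y ∈ supportBox Ξ i) : dist x y < δ := by
  rw [dist_pi_lt_iff hδ]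
  intro k
  have h1 := hx k (Set.mem_univ k)
  have h2 := hy k (Set.mem_univ k)
  have h3 := (Ξ k).knot_sub_le (fun i hi => knot_sub_le_meshSize Ξ k hi) (i k) (p + 1) (by omega)
  rw [lt_div_iff₀ (by positivity)] at hmesh
  rw [← add_assoc] at h3
  push_cast at h3
  rw [Real.dist_eq, abs_lt]
  constructor <;> nlinarith [h1.1, h1.2, h2.1, h2.2]

/-! ### Condition number of spectrally equivalent matrices -/

section Spectral

open scoped MatrixOrder

/-- If the quadratic forms of `M` and `P` differ by at most the fraction `θ` of that of `P`, the
eigenvalues of `P^{-1/2} M P^{-1/2}` lie in `[1 - θ, 1 + θ]`: with `v` an eigenvector for `c` and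
`z = P^{-1/2} v` one has `M z = c P z`. -/
theorem abs_condNumber_symmPrecond_sub_one_le {n : Type*} [Fintype n] [DecidableEq n] [Nonempty n]
    {P M : Matrix n n ℝ} (hP : P.PosDef) (hM : M.PosDef) {θ : ℝ} (hθ : 0 ≤ θ) (hθ' : θ < 1)
    (hPM : ∀ x : n → ℝ, |x ⬝ᵥ (M - P).mulVec x| ≤ θ * (x ⬝ᵥ P.mulVec x)) :
    |condNumber (symmPrecond P M) - 1| ≤ 2 * θ / (1 - θ) := by
  set R := CFC.sqrt P with hR
  have hRR : R * R = P := CFC.sqrt_mul_sqrt_self P hP.posSemidef.nonneg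
  have hRh : R.IsHermitian := (Matrix.nonneg_iff_posSemidef.1 (CFC.sqrt_nonneg P)).isHermitian
  have hRu : IsUnit R.det := by
    have h := (Matrix.isUnit_iff_isUnit_det _).1 hP.isUnit
    rw [← hRR, Matrix.det_mul] at h
    exact isUnit_of_mul_isUnit_left h
  have hA : (symmPrecond P M).IsHermitian := by
    have := Matrix.isHermitian_mul_mul_conjTranspose R⁻¹ hM.isHermitian
    rwa [hRh.inv.eq] at this
  have hspec : ∀ c ∈ spectrum ℝ (symmPrecond P M), c ∈ Set.Icc (1 - θ) (1 + θ) := by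
    intro c hc
    rw [hA.spectrum_real_eq_range_eigenvalues] at hc
    obtain ⟨i, rfl⟩ := hc
    set c := hA.eigenvalues i with hc
    obtain ⟨v, hv0, hv⟩ : ∃ v : n → ℝ, v ≠ 0 ∧ (symmPrecond P M).mulVec v = c • v := by
      refine ⟨hA.eigenvectorBasis i, fun h => ?_, hA.mulVec_eigenvectorBasis i⟩
      exact hA.eigenvectorBasis.orthonormal.ne_zero i (by ext j; simpa using congrFun h j)
    set z := R⁻¹.mulVec v with hz
    have hRz : R.mulVec z = v := by
      rw [hz, Matrix.mulVec_mulVec, Matrix.mul_nonsing_inv _ hRu, Matrix.one_mulVec]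
    have hz0 : z ≠ 0 := by
      intro h
      rw [h, Matrix.mulVec_zero] at hRz
      exact hv0 hRz.symm
    have hMz : M.mulVec z = c • P.mulVec z := by
      have h1 : R.mulVec ((symmPrecond P M).mulVec v) = M.mulVec z := by
        rw [symmPrecond, ← hR, Matrix.mul_assoc, ← Matrix.mulVec_mulVec, ← Matrix.mulVec_mulVec,
          Matrix.mulVec_mulVec, Matrix.mul_nonsing_inv _ hRu, Matrix.one_mulVec]
      rw [← h1, hv, Matrix.mulVec_smul, ← hRR, ← Matrix.mulVec_mulVec, hRz]
    have hpos : 0 < z ⬝ᵥ P.mulVec z := by simpa using hP.dotProduct_mulVec_pos hz0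
    have h2 := hPM z
    rw [Matrix.sub_mulVec, dotProduct_sub, hMz, dotProduct_smul, smul_eq_mul,
      ← sub_one_mul, abs_mul, abs_of_pos hpos] at h2
    have h3 := abs_le.1 (le_of_mul_le_mul_right h2 hpos)
    exact ⟨by linarith [h3.1], by linarith [h3.2]⟩
  have hne : (spectrum ℝ (symmPrecond P M)).Nonempty := by
    rw [hA.spectrum_real_eq_range_eigenvalues]
    exact Set.range_nonempty _
  have hbelow : BddBelow (spectrum ℝ (symmPrecond P M)) := ⟨_, fun c hc => (hspec c hc).1⟩
  have habove : BddAbove (spectrum ℝ (symmPrecond P M)) := ⟨_, fun c hc => (hspec c hc).2⟩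
  have h1 : 1 - θ ≤ sInf (spectrum ℝ (symmPrecond P M)) := le_csInf hne fun c hc => (hspec c hc).1
  have h2 : sSup (spectrum ℝ (symmPrecond P M)) ≤ 1 + θ := csSup_le hne fun c hc => (hspec c hc).2
  have h3 : sInf (spectrum ℝ (symmPrecond P M)) ≤ sSup (spectrum ℝ (symmPrecond P M)) :=
    (csInf_le hbelow hne.some_mem).trans (le_csSup habove hne.some_mem)
  have hpos : 0 < sInf (spectrum ℝ (symmPrecond P M)) := by linarith
  rw [condNumber, div_sub_one hpos.ne', abs_of_nonneg (div_nonneg (by linarith) hpos.le)]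
  exact div_le_div₀ (by linarith) (by linarith) (by linarith) h1

end Spectral

end SplineMass

theorem theorem3p1 (d p : ℕ) (hd : 1 ≤ d) (hp : 1 ≤ p) (α : ℝ) (hα : 0 < α)
    (ω : (Fin d → ℝ) → ℝ) (hω : ContinuousOn ω (Set.Icc 0 1))
    (hω_pos : ∀ x ∈ Set.Icc (0 : Fin d → ℝ) 1, 0 < ω x) :
    (∀ (m : ℕ) (Ξ : Fin d → SplineMass.OpenKnotVector p m),
      (SplineMass.massMatrix Ξ ω).PosDef ∧ (SplineMass.preconditioner Ξ ω).PosDef) ∧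
    ∀ ε : ℝ, 0 < ε → ∃ δ : ℝ, 0 < δ ∧
      ∀ (m : ℕ) (Ξ : Fin d → SplineMass.OpenKnotVector p m),
        SplineMass.QuasiUniform α Ξ → SplineMass.meshSize Ξ < δ →
          |SplineMass.condNumber
              (SplineMass.symmPrecond (SplineMass.preconditioner Ξ ω)
                (SplineMass.massMatrix Ξ ω)) - 1| < ε := by
  open SplineMass in
  have hint : Integrable ω (cubeMeasure d) :=
    (hω.integrableOn_compact isCompact_Icc).mono_set fun x hx =>
      ⟨fun k => (hx k (Set.mem_univ k)).1.le, fun k => (hx k (Set.mem_univ k)).2.le⟩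
  obtain ⟨x₀, hx₀, hmin⟩ := isCompact_Icc.exists_isMinOn
    (Set.nonempty_Icc.2 (zero_le_one (α := Fin d → ℝ))) hω
  set w := ω x₀ with hw_def
  have hw : 0 < w := hω_pos x₀ hx₀
  have hwω : ∀ x ∈ Set.Icc (0 : Fin d → ℝ) 1, w ≤ ω x := fun x hx => hmin hx
  have hω0 : ∀ x ∈ Set.Icc (0 : Fin d → ℝ) 1, 0 ≤ ω x := fun x hx => (hω_pos x hx).le
  have hpd : ∀ (m : ℕ) (Ξ : Fin d → OpenKnotVector p m),
      (massMatrix Ξ ω).PosDef ∧ (preconditioner Ξ ω).PosDef := by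
    intro m Ξ
    -- every single family of knot vectors is quasi-uniform, with spans of length at most `1`
    obtain ⟨β, hβ, hspan⟩ := exists_le_nonempty_span Ξ
    obtain ⟨L, hL, hstab⟩ := exists_stability_const d p hβ
    obtain ⟨hpos, hc⟩ := hstab m Ξ 1
      (fun k i hi => by
        have h1 := ((Ξ k).knot_mem_Icc (a := i + 1) (by omega)).2
        have h2 := ((Ξ k).knot_mem_Icc (a := i) (by omega)).1
        linarith)
      (fun k i hi hlt => by simpa using hspan k i hi hlt)
    exact ⟨posDef_of_sum_le (massMatrix_isHermitian Ξ ω) hpos hw hL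
        (sum_le_dotProduct_massMatrix_mulVec hint hw.le hwω hc hL.le),
      posDef_of_sum_le (preconditioner_isHermitian Ξ ω) hpos hw hL
        (sum_le_dotProduct_preconditioner_mulVec hint hw.le hwω hpos hc)⟩
  refine ⟨hpd, fun ε hε => ?_⟩
  obtain ⟨L, hL, hstab⟩ := exists_stability_const d p hα
  -- `2 θ / (1 - θ) ≤ 4 θ < ε` for `θ ≤ 1 / 2` and `θ ≤ ε / 8`
  set θ : ℝ := min (1 / 2) (ε / 8) with hθ_def
  have hθ : 0 < θ := by positivity
  have hθ1 : θ ≤ 1 / 2 := min_le_left _ _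
  have hθ2 : θ ≤ ε / 8 := min_le_right _ _
  set η : ℝ := θ * w / (L * (p + 1) ^ d) with hη_def
  have hη : 0 < η := by positivity
  obtain ⟨δ, hδ, hunif⟩ := Metric.uniformContinuousOn_iff.1
    (isCompact_Icc.uniformContinuousOn_of_continuous hω) η hη
  refine ⟨δ / (p + 1), by positivity, fun m Ξ hqu hmesh => ?_⟩
  obtain ⟨hpos, hc⟩ := hstab m Ξ (meshSize Ξ) (fun k i hi => knot_sub_le_meshSize Ξ k hi) hqu
  have hosc : ∀ i, ∀ x ∈ supportBox Ξ i, x ∈ Set.Icc (0 : Fin d → ℝ) 1 →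
      ∀ y ∈ supportBox Ξ i, y ∈ Set.Icc (0 : Fin d → ℝ) 1 → |ω x - ω y| ≤ η :=
    fun i x hx hx' y hy hy' =>
      (hunif x hx' y hy' (dist_lt_of_mem_supportBox Ξ hδ hmesh hx hy)).le
  have : Nonempty (Fin m) := ⟨⟨0, (Nat.zero_le p).trans_lt (Ξ ⟨0, hd⟩).degree_lt⟩⟩
  have hPM : ∀ c : (Fin d → Fin m) → ℝ,
      |c ⬝ᵥ (massMatrix Ξ ω - preconditioner Ξ ω).mulVec c| ≤
        θ * (c ⬝ᵥ (preconditioner Ξ ω).mulVec c) := by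
    intro c
    refine (abs_dotProduct_sub_mulVec_le hint hω0 hpos hη.le hosc c).trans ?_
    have h1 := sum_le_dotProduct_preconditioner_mulVec hint hw.le hwω hpos hc c
    calc η * ((p + 1) ^ d * ∑ i, c i ^ 2 * parametricMass Ξ i i)
        = θ / L * (w * ∑ i, c i ^ 2 * parametricMass Ξ i i) := by
          rw [hη_def]; field_simp
      _ ≤ θ / L * (L * (c ⬝ᵥ (preconditioner Ξ ω).mulVec c)) :=
          mul_le_mul_of_nonneg_left h1 (by positivity)
      _ = θ * (c ⬝ᵥ (preconditioner Ξ ω).mulVec c) := by field_simp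
  refine (abs_condNumber_symmPrecond_sub_one_le (hpd m Ξ).2 (hpd m Ξ).1 hθ.le (by linarith)
    hPM).trans_lt ?_
  rw [div_lt_iff₀ (by linarith)]
  nlinarith
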